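/- Let $\mathcal H$ be a complex Hilbert space and let $\rho(\theta)=|\phi(\theta)\rangle\langle\phi(\theta)|$ be an $m$-parameter pure-state model, where $\phi$ is a differentiable family of unit vectors in $\mathcal H$ on an open set $\Theta\subseteq\mathbb R^m$. Fix $\theta\in\Theta$ and put $$|l_j\rangle=2\bigl(\partial_j\phi(\theta)-\langle\phi(\theta)|\partial_j\phi(\theta)\rangle\,\phi(\theta)\bigr),\qquad J^S=\bigl[\mathrm{Re}\langle l_i|l_j\rangle\bigr],\qquad \tilde J=\bigl[\mathrm{Im}\langle l_i|l_j\rangle\bigr].$$ The model is *coherent* at $\theta$ if $J^S$ is invertible and all complex eigenvalues of $J^{S-1}\tilde J$ are $\pm i$. A measurement is a positive operator valued measure $M$ on $\mathbb R^m$ acting on $\mathcal H$. Write $p_{\theta'}(B)=\mathrm{tr}\,\rho(\theta')M(B)$ for its outcome distribution at $\theta'$, $E_{\theta'}[M]=\int\hat\theta\,p_{\theta'}(d\hat\theta)$ for its mean and $V_{\theta'}[M]$ for its covariance matrix. $M$ is *locally unbiased* at $\theta$ if $p_\theta$ has finite second moments, $E_\theta[M]=\theta$, for each $j$ the mean $E_{\theta'}[M]$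 exists for $\theta'$ near $\theta$ on the line through $\theta$ in the $j$-th coordinate direction, $\partial_jE_\theta[M]^i=\delta^i_j$, and the derivative may be taken under the integral sign, i.e. $\int\hat\theta^i\,\mathrm{tr}\bigl(\partial_j\rho(\theta)\,M(d\hat\theta)\bigr)=\delta^i_j$ (which is automatic if $\dim\mathcal H<\infty$). Let $\mathcal V$ be the set of all $V_\theta[M]$ with $M$ locally unbiased at $\theta$, and for a weight matrix $G$, i.e. a real symmetric nonnegative definite $m\times m$ matrix, let the attainable Cramér–Rao type bound be $$\mathrm{CR}(G)=\inf\{\mathrm{Tr}\,GV : V\in\mathcal V\}.$$ Let $\mathrm{Tr}\,\mathrm{abs}\,A$ denote the sum of the absolute values of the complex eigenvalues of $A$, counted with algebraic multiplicity, and let $|A|=(AA^*)^{1/2}$. **Theorem.** Suppose that the model is coherent at $\theta$. Then for every weight matrix $G$ the infimum is finite (that is, $\mathcal V$ is nonempty and $\mathrm{Tr}\,GV$ is bounded below on it) and $$\mathrm{CR}(G)=\mathrm{Tr}\,GJ^{S-1}+\mathrm{Tr}\,\mathrm{abs}\,GJ^{S-1}\tilde JJ^{S-1}.$$ If $G$ is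 strictly positive definite, the infimum is a minimum, and it is attained by the covariance matrix $$V=J^{S-1}+G^{-1/2}\bigl|G^{1/2}J^{S-1}\tilde JJ^{S-1}G^{1/2}\bigr|G^{-1/2}\in\mathcal V.$$ -/

import Mathlib

open MeasureTheory

namespace QuantumEstimation

/-- A measurement (positive operator valued measure) on the complex Hilbert space `H` with
outcomes in `Ω`.  The countable sums converge in the strong operator topology; for positive
operators of total sum at most `1` this is the same as weak convergence. -/
structure Measurement (Ω : Type*) [MeasurableSpace Ω] (H : Type*) [NormedAddCommGroup H]
    [InnerProductSpace ℂ H] [CompleteSpace H] where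
  /-- the operator `M(B)` attached to an event `B` -/
  effect : Set Ω → H →L[ℂ] H
  isPositive : ∀ B, MeasurableSet B → (effect B).IsPositive
  empty : effect ∅ = 0
  univ : effect Set.univ = 1
  iUnion : ∀ B : ℕ → Set Ω, (∀ k, MeasurableSet (B k)) →
    Pairwise (fun k l => Disjoint (B k) (B l)) →
    ∀ ψ : H, HasSum (fun k => effect (B k) ψ) (effect (⋃ k, B k) ψ)

namespace Measurement

variable {Ω : Type*} [MeasurableSpace Ω] {H : Type*} [NormedAddCommGroup H]
  [InnerProductSpace ℂ H] [CompleteSpace H]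

theorem hasSum_re (M : Measurement Ω H) (χ ψ : H) (B : ℕ → Set Ω)
    (hB : ∀ k, MeasurableSet (B k)) (hd : Pairwise (fun k l => Disjoint (B k) (B l))) :
    HasSum (fun k => (inner ℂ χ (M.effect (B k) ψ)).re)
      (inner ℂ χ (M.effect (⋃ k, B k) ψ)).re := by
  have h := M.iUnion B hB hd ψ
  have h1 := (innerSL ℂ χ).hasSum h
  have h2 := Complex.reCLM.hasSum h1
  simpa [Function.comp_def] using h2

/-- The distribution of the outcome in the pure state `|ψ⟩⟨ψ|`:
`Pr(B) = tr (|ψ⟩⟨ψ| M(B)) = ⟨ψ|M(B)ψ⟩`. -/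
noncomputable def outcome (M : Measurement Ω H) (ψ : H) : Measure Ω :=
  Measure.ofMeasurable (fun B _ => ENNReal.ofReal (inner ℂ ψ (M.effect B ψ)).re)
    (by simp [M.empty])
    (by
      intro B hB hd
      have h := M.hasSum_re ψ ψ B hB hd
      have hnn : ∀ k, 0 ≤ (inner ℂ ψ (M.effect (B k) ψ)).re := fun k =>
        (M.isPositive (B k) (hB k)).re_inner_nonneg_right ψ
      rw [← h.tsum_eq, ENNReal.ofReal_tsum_of_nonneg hnn h.summable])

open Classical in
/-- The signed measure `B ↦ 2 Re ⟨χ|M(B)ψ⟩ = tr ((|χ⟩⟨ψ| + |ψ⟩⟨χ|) M(B))`.  For `ψ = φ(θ)` and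
`χ = ∂ⱼφ(θ)` this is `B ↦ tr (∂ⱼρ(θ) M(B)) = ∂ⱼ Pr(B | θ)`. -/
noncomputable def outcomeVariation (M : Measurement Ω H) (χ ψ : H) : SignedMeasure Ω where
  measureOf' B := if MeasurableSet B then 2 * (inner ℂ χ (M.effect B ψ)).re else 0
  empty' := by simp [M.empty]
  not_measurable' B hB := by simp [hB]
  m_iUnion' B hB hd := by
    have h := (M.hasSum_re χ ψ B hB hd).mul_left 2
    simpa [hB, MeasurableSet.iUnion hB] using h

end Measurement

/-- An `m`-parameter pure state model `ρ(θ) = |φ(θ)⟩⟨φ(θ)|`, given by a differentiable family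
of unit vectors on an open parameter set `Θ ⊆ ℝᵐ`. -/
structure PureStateModel (m : ℕ) (H : Type*) [NormedAddCommGroup H]
    [InnerProductSpace ℂ H] [CompleteSpace H] where
  Θ : Set (EuclideanSpace ℝ (Fin m))
  isOpen_Θ : IsOpen Θ
  φ : EuclideanSpace ℝ (Fin m) → H
  differentiableOn_φ : DifferentiableOn ℝ φ Θ
  norm_φ : ∀ θ ∈ Θ, ‖φ θ‖ = 1

/-- The sum of the absolute values of the complex eigenvalues of a real square matrix, counted
with algebraic multiplicity. -/
noncomputable def trAbs {m : ℕ} (A : Matrix (Fin m) (Fin m) ℝ) : ℝ :=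
  ((A.map Complex.ofReal).charpoly.roots.map (fun z : ℂ => ‖z‖)).sum

open scoped MatrixOrder in
/-- The positive semidefinite square root of a positive semidefinite real matrix. -/
noncomputable def matSqrt {m : ℕ} (A : Matrix (Fin m) (Fin m) ℝ) : Matrix (Fin m) (Fin m) ℝ :=
  CFC.sqrt A

/-- `|A| = (A Aᵀ)^{1/2}`. -/
noncomputable def matAbs {m : ℕ} (A : Matrix (Fin m) (Fin m) ℝ) : Matrix (Fin m) (Fin m) ℝ :=
  matSqrt (A * A.transpose)

namespace PureStateModel

variable {m : ℕ} {H : Type*} [NormedAddCommGroup H] [InnerProductSpace ℂ H] [CompleteSpace H]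

/-- The partial derivative `∂ⱼφ(θ)`. -/
noncomputable def partialφ (S : PureStateModel m H) (θ : EuclideanSpace ℝ (Fin m))
    (j : Fin m) : H :=
  fderiv ℝ S.φ θ (EuclideanSpace.single j 1)

/-- The horizontal lift `|lⱼ⟩ = 2 (∂ⱼφ - ⟨φ|∂ⱼφ⟩ φ)`, the vector with
`∂ⱼρ = (|lⱼ⟩⟨φ| + |φ⟩⟨lⱼ|) / 2` and `⟨lⱼ|φ⟩ = 0`. -/
noncomputable def lift (S : PureStateModel m H) (θ : EuclideanSpace ℝ (Fin m))
    (j : Fin m) : H :=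
  (2 : ℂ) • (S.partialφ θ j - (inner ℂ (S.φ θ) (S.partialφ θ j)) • S.φ θ)

/-- The SLD Fisher information matrix `Jˢ = Re [⟨lᵢ|lⱼ⟩]`. -/
noncomputable def fisher (S : PureStateModel m H) (θ : EuclideanSpace ℝ (Fin m)) :
    Matrix (Fin m) (Fin m) ℝ :=
  Matrix.of fun i j => (inner ℂ (S.lift θ i) (S.lift θ j)).re

/-- The matrix `J̃ = Im [⟨lᵢ|lⱼ⟩]`. -/
noncomputable def fisherIm (S : PureStateModel m H) (θ : EuclideanSpace ℝ (Fin m)) :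
    Matrix (Fin m) (Fin m) ℝ :=
  Matrix.of fun i j => (inner ℂ (S.lift θ i) (S.lift θ j)).im

/-- The model is coherent at `θ`: `Jˢ` is invertible and every complex eigenvalue of
`(Jˢ)⁻¹ J̃` is `i` or `-i`. -/
def IsCoherentAt (S : PureStateModel m H) (θ : EuclideanSpace ℝ (Fin m)) : Prop :=
  IsUnit (S.fisher θ).det ∧
    ∀ z ∈ spectrum ℂ (((S.fisher θ)⁻¹ * S.fisherIm θ).map Complex.ofReal),
      z = Complex.I ∨ z = -Complex.I

/-- `E_θ[M]`, the mean of the estimate. -/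
noncomputable def mean (S : PureStateModel m H)
    (M : Measurement (EuclideanSpace ℝ (Fin m)) H) (θ : EuclideanSpace ℝ (Fin m)) :
    EuclideanSpace ℝ (Fin m) :=
  ∫ x, x ∂(M.outcome (S.φ θ))

/-- `V_θ[M]`, the covariance matrix of the estimate. -/
noncomputable def covarianceMatrix (S : PureStateModel m H)
    (M : Measurement (EuclideanSpace ℝ (Fin m)) H) (θ : EuclideanSpace ℝ (Fin m)) :
    Matrix (Fin m) (Fin m) ℝ :=
  Matrix.of fun i j =>
    ProbabilityTheory.covariance (fun x : EuclideanSpace ℝ (Fin m) => x i) (fun x => x j)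
      (M.outcome (S.φ θ))

/-- `M` is a locally unbiased measurement at `θ`, with finite second moments.  The conditions are
`E_θ[M] = θ` and `∂ⱼ E_θ[M]ⁱ = δᵢⱼ`, where the derivative may be taken under the integral sign
(`⟨φ|xⁱ⟩ = 0` and `Re ⟨lⱼ|xⁱ⟩ = δᵢⱼ` in terms of the estimation vectors
`xⁱ = ∫ (x̂ⁱ - θⁱ) M(dx̂) φ(θ)`).  The last condition follows from the others if `H` is
finite-dimensional. -/
structure IsLocallyUnbiased (S : PureStateModel m H)
    (M : Measurement (EuclideanSpace ℝ (Fin m)) H) (θ : EuclideanSpace ℝ (Fin m)) : Prop where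
  memLp : MemLp (fun x : EuclideanSpace ℝ (Fin m) => x) 2 (M.outcome (S.φ θ))
  mean_eq : S.mean M θ = θ
  integrable : ∀ j : Fin m, ∀ᶠ t : ℝ in nhds 0,
    Integrable (fun x : EuclideanSpace ℝ (Fin m) => x)
      (M.outcome (S.φ (θ + t • EuclideanSpace.single j 1)))
  hasDerivAt_mean : ∀ j : Fin m,
    HasDerivAt (fun t : ℝ => S.mean M (θ + t • EuclideanSpace.single j 1))
      (EuclideanSpace.single j 1) 0
  deriv_under_integral : ∀ i j : Fin m,
    ∫ᵛ x, x i ∂•(M.outcomeVariation (S.partialφ θ j) (S.φ θ))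
      = if i = j then 1 else 0

/-- The set `𝒱_θ` of the covariance matrices of the locally unbiased measurements at `θ`. -/
def covarianceRegion (S : PureStateModel m H) (θ : EuclideanSpace ℝ (Fin m)) :
    Set (Matrix (Fin m) (Fin m) ℝ) :=
  {V | ∃ M : Measurement (EuclideanSpace ℝ (Fin m)) H,
    S.IsLocallyUnbiased M θ ∧ S.covarianceMatrix M θ = V}

/-- The values `Tr G V`, `V ∈ 𝒱_θ`. -/
def weightedCosts (S : PureStateModel m H) (θ : EuclideanSpace ℝ (Fin m))
    (G : Matrix (Fin m) (Fin m) ℝ) : Set ℝ :=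
  (fun V => (G * V).trace) '' S.covarianceRegion θ

/-- The attainable Cramér–Rao type bound `CR(G)` at `θ`. -/
noncomputable def crBound (S : PureStateModel m H) (θ : EuclideanSpace ℝ (Fin m))
    (G : Matrix (Fin m) (Fin m) ℝ) : ℝ :=
  sInf (S.weightedCosts θ G)

/-- `Tr G Jˢ⁻¹ + Tr abs (G Jˢ⁻¹ J̃ Jˢ⁻¹)`. -/
noncomputable def coherentBound (S : PureStateModel m H) (θ : EuclideanSpace ℝ (Fin m))
    (G : Matrix (Fin m) (Fin m) ℝ) : ℝ :=
  (G * (S.fisher θ)⁻¹).trace + trAbs (G * (S.fisher θ)⁻¹ * S.fisherIm θ * (S.fisher θ)⁻¹)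

/-- `Jˢ⁻¹ + G^{-1/2} |G^{1/2} Jˢ⁻¹ J̃ Jˢ⁻¹ G^{1/2}| G^{-1/2}`. -/
noncomputable def coherentCovariance (S : PureStateModel m H) (θ : EuclideanSpace ℝ (Fin m))
    (G : Matrix (Fin m) (Fin m) ℝ) : Matrix (Fin m) (Fin m) ℝ :=
  (S.fisher θ)⁻¹ + (matSqrt G)⁻¹ *
    matAbs (matSqrt G * (S.fisher θ)⁻¹ * S.fisherIm θ * (S.fisher θ)⁻¹ * matSqrt G) *
    (matSqrt G)⁻¹

end PureStateModel

end QuantumEstimation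

/-! Write A for the inverse of the Fisher matrix and K = A J̃ A. The family dual to the lifts for
Re⟨·|·⟩ (`dualFamily`) has Gram matrix A + iK. The proof rests on comparing covariance matrices V
with this Hermitian matrix.

Lower bound. Positivity of the effects gives, for square integrable F = f + ig and any vector w, the
relation Re ∫ F d(2⟨w|Mφ⟩) ≤ ∫ |F|² dp + ‖w‖² (`integral_add_integral_le`). Take F = Σ (aᵢ + i
bᵢ)(xⁱ - θⁱ) and w the same combination of dual vectors. Coherence says that (A J̃)² = -1, so the
real span of the lifts is a complex subspace. Then w and -iw are both real combinations of lifts,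
local unbiasedness determines the left side as 2‖w‖², and V ≥ A + iK follows
(`dominates_of_mem_covarianceRegion`). With X = G^{1/2} K G^{1/2} and W = G^{1/2} (V - A) G^{1/2}
this reads W ≥ iX; conjugation gives W ≥ -iX, so W dominates |iX| in trace (`trAbs_le_trace`).

Attainment. Conversely, every positive definite V ≥ A + iK is the covariance of a locally unbiased
measurement with finitely many outcomes (`mem_covarianceRegion_of_dominates`). For G > 0 the matrix
A + G^{-1/2} |X| G^{-1/2} qualifies because |X| ≥ iX, and its cost equals the lower bound because Tr
|X| = Tr abs X. For singular G the weights (G^{1/2} + ε)² approach the bound as ε → 0. -/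

namespace QuantumEstimation

open Matrix
open scoped MatrixOrder ComplexOrder

/-! ### Real antisymmetric matrices: eigenvalues, absolute value, Hermitian domination -/

section MatrixInequalities

variable {m : ℕ}

theorem re_star_dotProduct_mulVec_sub_smul (W X : Matrix (Fin m) (Fin m) ℝ)
    (hX : Xᵀ = -X) (c : Fin m → ℂ) :
    (star c ⬝ᵥ ((W.map Complex.ofReal - Complex.I • X.map Complex.ofReal) *ᵥ c)).re =
      (fun i => (c i).re) ⬝ᵥ (W *ᵥ fun i => (c i).re) +
      (fun i => (c i).im) ⬝ᵥ (W *ᵥ fun i => (c i).im) -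
      2 * ((fun i => (c i).im) ⬝ᵥ (X *ᵥ fun i => (c i).re)) := by
  have hswap : (fun i => (c i).re) ⬝ᵥ (X *ᵥ fun i => (c i).im) =
      -((fun i => (c i).im) ⬝ᵥ (X *ᵥ fun i => (c i).re)) := by
    rw [← vecMul_transpose, hX, dotProduct_comm, ← dotProduct_mulVec, neg_mulVec, dotProduct_neg]
  have key : (star c ⬝ᵥ ((W.map Complex.ofReal - Complex.I • X.map Complex.ofReal) *ᵥ c)).re =
      (fun i => (c i).re) ⬝ᵥ (W *ᵥ fun i => (c i).re) +
      (fun i => (c i).im) ⬝ᵥ (W *ᵥ fun i => (c i).im) +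
      ((fun i => (c i).re) ⬝ᵥ (X *ᵥ fun i => (c i).im) -
      (fun i => (c i).im) ⬝ᵥ (X *ᵥ fun i => (c i).re)) := by
    simp only [dotProduct, mulVec, Finset.mul_sum, Complex.re_sum, ← Finset.sum_add_distrib,
      ← Finset.sum_sub_distrib]
    refine Finset.sum_congr rfl fun i _ => Finset.sum_congr rfl fun j _ => ?_
    simp
    ring
  rw [key, hswap]
  ring

theorem isHermitian_map_sub_smul {W X : Matrix (Fin m) (Fin m) ℝ} (hW : Wᵀ = W) (hX : Xᵀ = -X) :
    (W.map Complex.ofReal - Complex.I • X.map Complex.ofReal).IsHermitian := by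
  ext i j
  have h1 : W j i = W i j := congrFun (congrFun hW i) j
  have h2 : X j i = -X i j := congrFun (congrFun hX i) j
  simp [h1, h2, sub_eq_add_neg]

/-- The hypothesis is the quadratic form of W - iX at c = a + ib, written in real terms.
Inequalities between complex Hermitian matrices are stated in this two-vector real form throughout.
-/
theorem posSemidef_map_sub_smul {W X : Matrix (Fin m) (Fin m) ℝ} (hW : Wᵀ = W) (hX : Xᵀ = -X)
    (h : ∀ a b : Fin m → ℝ, 2 * (b ⬝ᵥ (X *ᵥ a)) ≤ a ⬝ᵥ (W *ᵥ a) + b ⬝ᵥ (W *ᵥ b)) :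
    (W.map Complex.ofReal - Complex.I • X.map Complex.ofReal).PosSemidef := by
  have hh := isHermitian_map_sub_smul hW hX
  refine Matrix.PosSemidef.of_dotProduct_mulVec_nonneg hh fun c => ?_
  rw [Complex.nonneg_iff]
  refine ⟨?_, (hh.im_star_dotProduct_mulVec_self c).symm⟩
  rw [re_star_dotProduct_mulVec_sub_smul W X hX]
  linarith [h (fun i => (c i).re) (fun i => (c i).im)]

theorem two_mul_dotProduct_le_of_posSemidef {W X : Matrix (Fin m) (Fin m) ℝ} (hX : Xᵀ = -X)
    (h : (W.map Complex.ofReal - Complex.I • X.map Complex.ofReal).PosSemidef)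
    (a b : Fin m → ℝ) : 2 * (b ⬝ᵥ (X *ᵥ a)) ≤ a ⬝ᵥ (W *ᵥ a) + b ⬝ᵥ (W *ᵥ b) := by
  have h1 := (Complex.nonneg_iff.1 (h.dotProduct_mulVec_nonneg
    (fun i => (a i : ℂ) + b i * Complex.I))).1
  rw [re_star_dotProduct_mulVec_sub_smul W X hX] at h1
  simp at h1
  linarith

theorem charpoly_smul_of_isHermitian {N : Matrix (Fin m) (Fin m) ℂ} (hN : N.IsHermitian) (c : ℂ) :
    (c • N).charpoly = ∏ i, (Polynomial.X - Polynomial.C (c * (hN.eigenvalues i : ℂ))) := by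
  conv_lhs => rw [hN.spectral_theorem, ← map_smul, Unitary.conjStarAlgAut_apply, charpoly_mul_comm,
    ← mul_assoc]
  rw [Unitary.coe_star_mul_self, one_mul, ← diagonal_smul, charpoly_diagonal]
  simp

theorem isHermitian_I_smul_map {X : Matrix (Fin m) (Fin m) ℝ} (hX : Xᵀ = -X) :
    (Complex.I • X.map Complex.ofReal).IsHermitian := by
  ext i j
  have h2 : X j i = -X i j := congrFun (congrFun hX i) j
  simp [h2]

/-- X = -i(iX) with iX Hermitian, so the complex eigenvalues of X are -i times the real eigenvalues
of iX. -/
theorem trAbs_eq_sum_abs_eigenvalues {X : Matrix (Fin m) (Fin m) ℝ} (hX : Xᵀ = -X) :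
    trAbs X = ∑ i, |(isHermitian_I_smul_map hX).eigenvalues i| := by
  have h : (X.map Complex.ofReal).charpoly =
      ((-Complex.I) • (Complex.I • X.map Complex.ofReal)).charpoly := by
    rw [smul_smul]; simp
  unfold trAbs
  rw [h, charpoly_smul_of_isHermitian (isHermitian_I_smul_map hX), Polynomial.roots_prod]
  · simp only [Polynomial.roots_X_sub_C, Multiset.bind_singleton, Multiset.map_map]
    exact Finset.sum_congr rfl fun i _ => by simp
  · exact Finset.prod_ne_zero_iff.2 fun i _ => Polynomial.X_sub_C_ne_zero _

/-- In an eigenbasis of N each diagonal entry of W is at least both λ and -λ for the corresponding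
eigenvalue λ. -/
theorem sum_abs_eigenvalues_le_trace {N W : Matrix (Fin m) (Fin m) ℂ} (hN : N.IsHermitian)
    (h1 : (W - N).PosSemidef) (h2 : (W + N).PosSemidef) :
    ∑ i, |hN.eigenvalues i| ≤ W.trace.re := by
  set U : Matrix (Fin m) (Fin m) ℂ := (hN.eigenvectorUnitary : Matrix (Fin m) (Fin m) ℂ)
  have hU : U * star U = 1 := Unitary.coe_mul_star_self _
  have hd : star U * N * U = diagonal (fun i => (hN.eigenvalues i : ℂ)) := by
    have := hN.conjStarAlgAut_star_eigenvectorUnitary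
    rw [Unitary.conjStarAlgAut_star_apply] at this
    exact this
  have ht : W.trace = (star U * W * U).trace := by
    rw [mul_assoc, trace_mul_comm, mul_assoc, hU, mul_one]
  rw [ht, trace, Complex.re_sum]
  refine Finset.sum_le_sum fun i _ => ?_
  have e1 := (Complex.nonneg_iff.1 ((h1.conjTranspose_mul_mul_same U).diag_nonneg (i := i))).1
  have e2 := (Complex.nonneg_iff.1 ((h2.conjTranspose_mul_mul_same U).diag_nonneg (i := i))).1
  rw [← star_eq_conjTranspose] at e1 e2
  rw [mul_sub, sub_mul, hd] at e1
  rw [mul_add, add_mul, hd] at e2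
  simp at e1 e2
  rw [diag_apply, abs_le]
  constructor <;> linarith

theorem trAbs_le_trace {W X : Matrix (Fin m) (Fin m) ℝ} (hW : Wᵀ = W) (hX : Xᵀ = -X)
    (h : ∀ a b : Fin m → ℝ, 2 * (b ⬝ᵥ (X *ᵥ a)) ≤ a ⬝ᵥ (W *ᵥ a) + b ⬝ᵥ (W *ᵥ b)) :
    trAbs X ≤ W.trace := by
  have h1 := posSemidef_map_sub_smul hW hX h
  -- Replacing b by -b in the hypothesis exchanges X and -X, so W + iX ≥ 0 comes for free.
  have h2 := posSemidef_map_sub_smul (X := -X) hW (by simp [hX]) (by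
    intro a b
    have := h a (-b)
    simp [neg_mulVec, mulVec_neg] at this ⊢
    linarith)
  rw [trAbs_eq_sum_abs_eigenvalues hX]
  have h3 := sum_abs_eigenvalues_le_trace (isHermitian_I_smul_map hX) h1 (by
    convert h2 using 1
    ext i j
    simp)
  refine h3.trans_eq ?_
  simp [trace]

theorem matSqrt_posSemidef (A : Matrix (Fin m) (Fin m) ℝ) : (matSqrt A).PosSemidef :=
  nonneg_iff_posSemidef.1 (CFC.sqrt_nonneg A)

theorem matSqrt_transpose (A : Matrix (Fin m) (Fin m) ℝ) : (matSqrt A)ᵀ = matSqrt A := by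
  simpa using (matSqrt_posSemidef A).1.eq

theorem matSqrt_mul_self {A : Matrix (Fin m) (Fin m) ℝ} (hA : A.PosSemidef) :
    matSqrt A * matSqrt A = A :=
  CFC.sqrt_mul_sqrt_self A (nonneg_iff_posSemidef.2 hA)

theorem isUnit_matSqrt {A : Matrix (Fin m) (Fin m) ℝ} (hA : A.PosDef) : IsUnit (matSqrt A) := by
  have h := hA.isUnit
  rw [← matSqrt_mul_self hA.posSemidef] at h
  exact isUnit_of_mul_isUnit_left h

/-- Both sides are positive square roots of (iX)² = X Xᵀ. This makes the functional calculus of the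
Hermitian matrix iX available for the real matrix |X|. -/
theorem map_matAbs {X : Matrix (Fin m) (Fin m) ℝ} (hX : Xᵀ = -X) :
    (matAbs X).map Complex.ofReal = cfc (fun x : ℝ => |x|) (Complex.I • X.map Complex.ofReal) := by
  set N := Complex.I • X.map Complex.ofReal with hNdef
  have hN : IsSelfAdjoint N := isHermitian_I_smul_map hX
  have hR : ((matAbs X).map Complex.ofReal).PosSemidef := by
    have := posSemidef_map_sub_smul (W := matAbs X) (X := 0) (matSqrt_transpose _) (by simp)
      (fun a b => by
        have h1 := (matSqrt_posSemidef (X * Xᵀ)).dotProduct_mulVec_nonneg a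
        have h2 := (matSqrt_posSemidef (X * Xᵀ)).dotProduct_mulVec_nonneg b
        simp only [star_trivial] at h1 h2
        simp only [zero_mulVec, dotProduct_zero, mul_zero]
        exact add_nonneg h1 h2)
    simpa using this
  have hP : 0 ≤ cfc (fun x : ℝ => |x|) N := cfc_nonneg fun x _ => abs_nonneg x
  have hPP : cfc (fun x : ℝ => |x|) N * cfc (fun x : ℝ => |x|) N = N * N := by
    rw [← cfc_mul (fun x : ℝ => |x|) (fun x : ℝ => |x|) N]
    simp only [abs_mul_abs_self]
    rw [cfc_mul (fun x : ℝ => x) (fun x : ℝ => x) N, cfc_id' ℝ N]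
  have hRR : (matAbs X).map Complex.ofReal * (matAbs X).map Complex.ofReal = N * N := by
    have h0 : matAbs X * matAbs X = X * Xᵀ :=
      matSqrt_mul_self (by simpa using posSemidef_self_mul_conjTranspose X)
    rw [show (matAbs X).map Complex.ofReal * (matAbs X).map Complex.ofReal =
      (matAbs X * matAbs X).map Complex.ofReal from (Matrix.map_mul (f := Complex.ofRealHom)).symm,
      h0, hX, hNdef]
    rw [show (X * -X).map Complex.ofReal = X.map Complex.ofReal * (-X).map Complex.ofReal from
      Matrix.map_mul (f := Complex.ofRealHom)]
    rw [smul_mul_smul_comm, Complex.I_mul_I, neg_smul, one_smul, ← mul_neg]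
    congr 1
    ext i j
    simp
  rw [← CFC.sqrt_unique hRR (nonneg_iff_posSemidef.2 hR), CFC.sqrt_unique hPP hP]

theorem trace_matAbs {X : Matrix (Fin m) (Fin m) ℝ} (hX : Xᵀ = -X) :
    (matAbs X).trace = trAbs X := by
  have h1 : (((matAbs X).trace : ℝ) : ℂ) = ((matAbs X).map Complex.ofReal).trace := by
    simp [trace]
  have hN := isHermitian_I_smul_map hX
  rw [trAbs_eq_sum_abs_eigenvalues hX]
  apply Complex.ofReal_injective
  rw [h1, map_matAbs hX, hN.cfc_eq, IsHermitian.cfc, Unitary.conjStarAlgAut_apply, trace_mul_comm,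
    ← mul_assoc, Unitary.coe_star_mul_self, one_mul, trace_diagonal]
  simp

/-- This is iX ≤ |iX|, the functional calculus of x ≤ |x|. -/
theorem two_mul_dotProduct_le_matAbs {X : Matrix (Fin m) (Fin m) ℝ} (hX : Xᵀ = -X)
    (a b : Fin m → ℝ) :
    2 * (b ⬝ᵥ (X *ᵥ a)) ≤ a ⬝ᵥ (matAbs X *ᵥ a) + b ⬝ᵥ (matAbs X *ᵥ b) := by
  refine two_mul_dotProduct_le_of_posSemidef hX ?_ a b
  rw [map_matAbs hX, ← nonneg_iff_posSemidef, sub_nonneg]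
  have hN : IsSelfAdjoint (Complex.I • X.map Complex.ofReal) := isHermitian_I_smul_map hX
  conv_lhs => rw [← cfc_id' ℝ (Complex.I • X.map Complex.ofReal)]
  exact cfc_mono fun x _ => le_abs_self x

theorem charpoly_map_mul_comm (A B : Matrix (Fin m) (Fin m) ℝ) :
    ((A * B).map Complex.ofReal).charpoly = ((B * A).map Complex.ofReal).charpoly := by
  rw [show (A * B).map Complex.ofReal = A.map Complex.ofReal * B.map Complex.ofReal from
      Matrix.map_mul (f := Complex.ofRealHom),
    show (B * A).map Complex.ofReal = B.map Complex.ofReal * A.map Complex.ofReal from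
      Matrix.map_mul (f := Complex.ofRealHom), charpoly_mul_comm]

/-- Only the characteristic polynomial matters. This moves one factor G^{1/2} across, replacing GK
by the antisymmetric G^{1/2} K G^{1/2}. -/
theorem trAbs_mul_comm (A B : Matrix (Fin m) (Fin m) ℝ) : trAbs (A * B) = trAbs (B * A) := by
  rw [trAbs, charpoly_map_mul_comm, trAbs]

/-- A crude bound from 2xy ≤ x² + y², entry by entry. It controls the terms of order ε and ε² when a
singular weight is perturbed. -/
theorem exists_two_mul_dotProduct_le (E : Matrix (Fin m) (Fin m) ℝ) :
    ∃ c : ℝ, ∀ a b : Fin m → ℝ, 2 * (b ⬝ᵥ (E *ᵥ a)) ≤ c * (a ⬝ᵥ a + b ⬝ᵥ b) := by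
  refine ⟨∑ i, ∑ j, |E i j|, fun a b => ?_⟩
  simp only [dotProduct, mulVec, Finset.mul_sum]
  rw [Finset.sum_mul]
  refine Finset.sum_le_sum fun i _ => ?_
  rw [Finset.sum_mul]
  refine Finset.sum_le_sum fun j _ => ?_
  have ha : a j * a j ≤ ∑ k, a k * a k :=
    Finset.single_le_sum (f := fun k => a k * a k) (fun k _ => mul_self_nonneg _)
      (Finset.mem_univ j)
  have hb : b i * b i ≤ ∑ k, b k * b k :=
    Finset.single_le_sum (f := fun k => b k * b k) (fun k _ => mul_self_nonneg _)
      (Finset.mem_univ i)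
  have h1 : 2 * (b i * (E i j * a j)) ≤ |E i j| * (a j * a j + b i * b i) := by
    rcases abs_cases (E i j) with ⟨h, h0⟩ | ⟨h, h0⟩ <;> rw [h]
    · nlinarith [mul_nonneg h0 (mul_self_nonneg (a j - b i))]
    · nlinarith [mul_nonneg (neg_nonneg.2 h0.le) (mul_self_nonneg (a j + b i))]
  exact h1.trans (mul_le_mul_of_nonneg_left (add_le_add ha hb) (abs_nonneg _))

end MatrixInequalities

end QuantumEstimation

namespace QuantumEstimation

open Matrix

/-! ### Gram matrices and the dual family -/

section GramMatrices

variable {m : ℕ} {H : Type*} [NormedAddCommGroup H] [InnerProductSpace ℂ H]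

/-- The real part of the Gram matrix of a family of vectors. -/
noncomputable def gramRe (l : Fin m → H) : Matrix (Fin m) (Fin m) ℝ :=
  Matrix.of fun i j => (inner ℂ (l i) (l j)).re

/-- The imaginary part of the Gram matrix of a family of vectors. -/
noncomputable def gramIm (l : Fin m → H) : Matrix (Fin m) (Fin m) ℝ :=
  Matrix.of fun i j => (inner ℂ (l i) (l j)).im

theorem gramRe_transpose (l : Fin m → H) : (gramRe l)ᵀ = gramRe l := by
  ext i j
  simp only [gramRe, transpose_apply, of_apply]
  rw [← inner_conj_symm, Complex.conj_re]

theorem gramIm_transpose (l : Fin m → H) : (gramIm l)ᵀ = -gramIm l := by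
  ext i j
  change (inner ℂ (l j) (l i)).im = -(inner ℂ (l i) (l j)).im
  rw [← inner_conj_symm, Complex.conj_im]

theorem norm_sq_sum_smul (l : Fin m → H) (c : Fin m → ℂ) :
    ‖∑ i, c i • l i‖ ^ 2 =
      (fun i => (c i).re) ⬝ᵥ (gramRe l *ᵥ fun i => (c i).re) +
      (fun i => (c i).im) ⬝ᵥ (gramRe l *ᵥ fun i => (c i).im) +
      2 * ((fun i => (c i).im) ⬝ᵥ (gramIm l *ᵥ fun i => (c i).re)) := by
  -- The complex Gram matrix is `gramRe l` + i `gramIm l`, hence X = -`gramIm l` in the form W - iX.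
  have h := re_star_dotProduct_mulVec_sub_smul (gramRe l) (-gramIm l)
    (by rw [transpose_neg, gramIm_transpose]) c
  rw [neg_mulVec, dotProduct_neg] at h
  rw [← inner_self_eq_norm_sq (𝕜 := ℂ), ← sub_neg_eq_add, ← mul_neg, ← h]
  simp only [sum_inner, inner_sum, inner_smul_left, inner_smul_right, dotProduct, mulVec,
    Finset.mul_sum, RCLike.re_eq_complex_re]
  rw [Finset.sum_comm]
  congr 1
  refine Finset.sum_congr rfl fun i _ => Finset.sum_congr rfl fun j _ => ?_
  have : ((gramRe l).map Complex.ofReal - Complex.I • (-gramIm l).map Complex.ofReal) i j =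
      inner ℂ (l i) (l j) := by
    apply Complex.ext <;> simp [gramRe, gramIm]
  rw [this]
  simp
  ring

theorem gramRe_posSemidef (l : Fin m → H) : (gramRe l).PosSemidef := by
  refine Matrix.PosSemidef.of_dotProduct_mulVec_nonneg ?_ fun a => ?_
  · rw [IsHermitian, conjTranspose_eq_transpose_of_trivial, gramRe_transpose]
  · have h := norm_sq_sum_smul l (fun i => (a i : ℂ))
    have h0 : (fun i => ((a i : ℂ)).im) = (0 : Fin m → ℝ) := by ext; simp
    rw [h0] at h
    simp at h
    simp only [star_trivial, ← h]
    positivity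

theorem gramRe_posDef {l : Fin m → H} (h : IsUnit (gramRe l).det) : (gramRe l).PosDef :=
  ((gramRe_posSemidef l).posDef_iff_det_ne_zero).2 h.ne_zero

/-- The family dual to `l` with respect to the real part of the inner product. -/
noncomputable def dualFamily (l : Fin m → H) (k : Fin m) : H :=
  ∑ j, (((gramRe l)⁻¹ k j : ℝ) : ℂ) • l j

theorem inv_gramRe_transpose (l : Fin m → H) : ((gramRe l)⁻¹)ᵀ = (gramRe l)⁻¹ := by
  rw [transpose_nonsing_inv, gramRe_transpose]

theorem re_inner_dualFamily {l : Fin m → H} (h : IsUnit (gramRe l).det) (j k : Fin m) :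
    (inner ℂ (l j) (dualFamily l k)).re = if j = k then 1 else 0 := by
  have h1 : (inner ℂ (l j) (dualFamily l k)).re = (gramRe l * ((gramRe l)⁻¹)ᵀ) j k := by
    simp only [dualFamily, inner_sum, inner_smul_right, Complex.re_sum, mul_apply, transpose_apply]
    refine Finset.sum_congr rfl fun i _ => ?_
    simp [gramRe, mul_comm]
  rw [h1, inv_gramRe_transpose, mul_nonsing_inv _ h, one_apply]

theorem sum_smul_dualFamily (l : Fin m → H) (c : Fin m → ℂ) :
    ∑ k, c k • dualFamily l k = ∑ j, (((gramRe l)⁻¹.map Complex.ofReal) *ᵥ c) j • l j := by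
  simp only [dualFamily, Finset.smul_sum, mulVec, dotProduct, Finset.sum_smul, smul_smul]
  rw [Finset.sum_comm]
  refine Finset.sum_congr rfl fun i _ => Finset.sum_congr rfl fun j _ => ?_
  congr 1
  have : (gramRe l)⁻¹ i j = (gramRe l)⁻¹ j i := congrFun (congrFun (inv_gramRe_transpose l) j) i
  simp [this, mul_comm]

theorem re_map_mulVec (A : Matrix (Fin m) (Fin m) ℝ) (c : Fin m → ℂ) :
    (fun i => (((A.map Complex.ofReal) *ᵥ c) i).re) = A *ᵥ fun i => (c i).re := by
  ext i
  simp [mulVec, dotProduct, Complex.re_sum]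

theorem im_map_mulVec (A : Matrix (Fin m) (Fin m) ℝ) (c : Fin m → ℂ) :
    (fun i => (((A.map Complex.ofReal) *ᵥ c) i).im) = A *ᵥ fun i => (c i).im := by
  ext i
  simp [mulVec, dotProduct, Complex.im_sum]

theorem mulVec_dotProduct_mulVec {A : Matrix (Fin m) (Fin m) ℝ} (hA : Aᵀ = A)
    (B : Matrix (Fin m) (Fin m) ℝ) (a b : Fin m → ℝ) :
    (A *ᵥ b) ⬝ᵥ (B *ᵥ (A *ᵥ a)) = b ⬝ᵥ ((A * B * A) *ᵥ a) := by
  rw [← vecMul_transpose, hA, ← dotProduct_mulVec, mulVec_mulVec, mulVec_mulVec, mul_assoc]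

theorem norm_sq_sum_smul_dualFamily {l : Fin m → H} (h : IsUnit (gramRe l).det) (c : Fin m → ℂ) :
    ‖∑ k, c k • dualFamily l k‖ ^ 2 =
      (fun i => (c i).re) ⬝ᵥ ((gramRe l)⁻¹ *ᵥ fun i => (c i).re) +
      (fun i => (c i).im) ⬝ᵥ ((gramRe l)⁻¹ *ᵥ fun i => (c i).im) +
      2 * ((fun i => (c i).im) ⬝ᵥ
        (((gramRe l)⁻¹ * gramIm l * (gramRe l)⁻¹) *ᵥ fun i => (c i).re)) := by
  rw [sum_smul_dualFamily, norm_sq_sum_smul, re_map_mulVec, im_map_mulVec]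
  simp only [mulVec_dotProduct_mulVec (inv_gramRe_transpose l)]
  rw [nonsing_inv_mul _ h, one_mul]

end GramMatrices

/-! ### Measurements with finitely many outcomes -/

section FiniteMeasurements

variable {Ω : Type*} [MeasurableSpace Ω] {H : Type*} [NormedAddCommGroup H]
  [InnerProductSpace ℂ H] [CompleteSpace H] {ι : Type*} [Fintype ι]

namespace Measurement

theorem outcome_apply (M : Measurement Ω H) (ψ : H) {B : Set Ω} (hB : MeasurableSet B) :
    M.outcome ψ B = ENNReal.ofReal (inner ℂ ψ (M.effect B ψ)).re :=
  Measure.ofMeasurable_apply B hB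

theorem outcomeVariation_apply (M : Measurement Ω H) (χ ψ : H) {B : Set Ω}
    (hB : MeasurableSet B) :
    M.outcomeVariation χ ψ B = 2 * (inner ℂ χ (M.effect B ψ)).re :=
  if_pos hB

open Classical in
/-- The measurement with finitely many outcomes `x i`, with effects `E i`. -/
noncomputable def ofFintype (x : ι → Ω) (E : ι → H →L[ℂ] H) (hE : ∀ i, (E i).IsPositive)
    (hsum : ∑ i, E i = 1) : Measurement Ω H where
  effect B := ∑ i, if x i ∈ B then E i else 0
  isPositive B _ := by
    refine ContinuousLinearMap.isPositive_sum _ fun i _ => ?_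
    split_ifs
    · exact hE i
    · exact ContinuousLinearMap.isPositive_zero
  empty := by simp
  univ := by simpa using hsum
  iUnion B _ hd ψ := by
    simp only [_root_.sum_apply]
    refine hasSum_sum fun i _ => ?_
    by_cases hi : x i ∈ ⋃ k, B k
    · obtain ⟨k, hk⟩ := Set.mem_iUnion.1 hi
      rw [if_pos hi]
      convert hasSum_single (f := fun k => (if x i ∈ B k then E i else 0) ψ) k ?_ using 1
      · simp [hk]
      · intro l hl
        have : x i ∉ B l := fun h => Set.disjoint_left.1 (hd hl) h hk
        simp [this]
    · rw [if_neg hi]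
      have : ∀ k, x i ∉ B k := fun k hk => hi (Set.mem_iUnion.2 ⟨k, hk⟩)
      simp [this, hasSum_zero]

variable (x : ι → Ω) (E : ι → H →L[ℂ] H) (hE : ∀ i, (E i).IsPositive) (hsum : ∑ i, E i = 1)

theorem outcome_ofFintype (ψ : H) :
    (ofFintype x E hE hsum).outcome ψ =
      ∑ i, ENNReal.ofReal (inner ℂ ψ (E i ψ)).re • Measure.dirac (x i) := by
  ext B hB
  rw [outcome_apply _ _ hB, Measure.finsetSum_apply]
  simp only [ofFintype, _root_.sum_apply, inner_sum, Complex.re_sum]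
  rw [ENNReal.ofReal_sum_of_nonneg]
  · refine Finset.sum_congr rfl fun i _ => ?_
    by_cases h : x i ∈ B <;> simp [h, hB]
  · intro i _
    split_ifs
    · exact (hE i).re_inner_nonneg_right ψ
    · simp

theorem integrable_outcome_ofFintype [MeasurableSingletonClass Ω] {F : Type*}
    [NormedAddCommGroup F] (ψ : H) (f : Ω → F) :
    Integrable f ((ofFintype x E hE hsum).outcome ψ) := by
  rw [outcome_ofFintype, integrable_finsetSum_measure]
  exact fun i _ => (integrable_dirac (by simp)).smul_measure ENNReal.ofReal_ne_top

theorem integral_outcome_ofFintype [MeasurableSingletonClass Ω] {F : Type*}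
    [NormedAddCommGroup F] [NormedSpace ℝ F] [CompleteSpace F] (ψ : H) (f : Ω → F) :
    ∫ ω, f ω ∂((ofFintype x E hE hsum).outcome ψ) = ∑ i, (inner ℂ ψ (E i ψ)).re • f (x i) := by
  rw [outcome_ofFintype, integral_finsetSum_measure]
  · refine Finset.sum_congr rfl fun i _ => ?_
    have h0 : 0 ≤ (inner ℂ ψ (E i ψ)).re := (hE i).re_inner_nonneg_right ψ
    rw [integral_smul_measure, integral_dirac, ENNReal.toReal_ofReal h0]
  · exact fun i _ => (integrable_dirac (by simp)).smul_measure ENNReal.ofReal_ne_top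

theorem integral_outcomeVariation_ofFintype [MeasurableSingletonClass Ω] (χ ψ : H) (f : Ω → ℝ) :
    ∫ᵛ ω, f ω ∂•((ofFintype x E hE hsum).outcomeVariation χ ψ) =
      ∑ i, 2 * (inner ℂ χ (E i ψ)).re * f (x i) := by
  have h : (ofFintype x E hE hsum).outcomeVariation χ ψ =
      ∑ i, VectorMeasure.dirac (x i) (2 * (inner ℂ χ (E i ψ)).re) := by
    ext B hB
    rw [outcomeVariation_apply _ _ _ hB]
    simp only [ofFintype, _root_.sum_apply, inner_sum, Complex.re_sum, Finset.mul_sum]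
    refine Finset.sum_congr rfl fun i _ => ?_
    by_cases h : x i ∈ B <;> simp [h, hB]
  rw [h, VectorMeasure.integral_finsetSum_vectorMeasure]
  · refine Finset.sum_congr rfl fun i _ => ?_
    simp [mul_comm]
  · intro i _
    rw [VectorMeasure.Integrable, VectorMeasure.variation_dirac]
    exact (integrable_dirac (by simp)).smul_measure enorm_ne_top

end Measurement

end FiniteMeasurements

end QuantumEstimation

/-! ### Derivatives of the model and a moment criterion for finite measurements -/

namespace QuantumEstimation

open Matrix

namespace PureStateModel

variable {m : ℕ} {H : Type*} [NormedAddCommGroup H] [InnerProductSpace ℂ H] [CompleteSpace H]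
  (S : PureStateModel m H) {θ : EuclideanSpace ℝ (Fin m)}

theorem fisher_eq_gramRe : S.fisher θ = gramRe (S.lift θ) := rfl

theorem fisherIm_eq_gramIm : S.fisherIm θ = gramIm (S.lift θ) := rfl

theorem hasDerivAt_partial (hθ : θ ∈ S.Θ) (j : Fin m) :
    HasDerivAt (fun t : ℝ => S.φ (θ + t • EuclideanSpace.single j 1)) (S.partialφ θ j) 0 := by
  have h : HasFDerivAt S.φ (fderiv ℝ S.φ θ) (θ + (0 : ℝ) • EuclideanSpace.single j 1) := by
    rw [zero_smul, add_zero]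
    exact (S.differentiableOn_φ.differentiableAt (S.isOpen_Θ.mem_nhds hθ)).hasFDerivAt
  have h2 : HasDerivAt (fun t : ℝ => θ + t • EuclideanSpace.single j (1 : ℝ))
      (EuclideanSpace.single j 1) 0 := by
    simpa using ((hasDerivAt_id (0 : ℝ)).smul_const (EuclideanSpace.single j (1 : ℝ))).const_add θ
  exact h.comp_hasDerivAt 0 h2

/-- By symmetry of T the two terms of the product rule are complex conjugates, so their real parts
agree. -/
theorem hasDerivAt_re_inner (hθ : θ ∈ S.Θ) (j : Fin m) {T : H →L[ℂ] H} (hT : T.IsPositive) :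
    HasDerivAt (fun t : ℝ => (inner ℂ (S.φ (θ + t • EuclideanSpace.single j 1))
      (T (S.φ (θ + t • EuclideanSpace.single j 1)))).re)
      (2 * (inner ℂ (S.partialφ θ j) (T (S.φ θ))).re) 0 := by
  have h := S.hasDerivAt_partial hθ j
  have hT' : HasDerivAt (fun t : ℝ => T (S.φ (θ + t • EuclideanSpace.single j 1)))
      (T (S.partialφ θ j)) 0 :=
    (T.restrictScalars ℝ).hasFDerivAt.comp_hasDerivAt 0 h
  have h3 := Complex.reCLM.hasFDerivAt.comp_hasDerivAt (0 : ℝ) (h.inner ℂ hT')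
  have hs : inner ℂ (S.φ θ) (T (S.partialφ θ j)) = inner ℂ (T (S.φ θ)) (S.partialφ θ j) :=
    (hT.isSymmetric (S.φ θ) (S.partialφ θ j)).symm
  rw [zero_smul, add_zero, hs, ← inner_conj_symm (T (S.φ θ)), map_add, Complex.reCLM_apply,
    Complex.reCLM_apply, Complex.conj_re, ← two_mul] at h3
  exact h3

/-- Differentiate ‖φ‖² = 1, the case T = 1 of the preceding derivative. -/
theorem re_inner_partial (hθ : θ ∈ S.Θ) (j : Fin m) :
    (inner ℂ (S.partialφ θ j) (S.φ θ)).re = 0 := by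
  have h := S.hasDerivAt_re_inner hθ j (T := 1) ContinuousLinearMap.isPositive_one
  have h2 : (fun t : ℝ => (inner ℂ (S.φ (θ + t • EuclideanSpace.single j 1))
      ((1 : H →L[ℂ] H) (S.φ (θ + t • EuclideanSpace.single j 1)))).re) =ᶠ[nhds 0]
      fun _ => 1 := by
    have hc : ContinuousAt (fun t : ℝ => θ + t • EuclideanSpace.single j (1 : ℝ)) 0 := by fun_prop
    have := hc.eventually_mem (s := S.Θ) (by simpa using S.isOpen_Θ.mem_nhds hθ)
    filter_upwards [this] with t ht
    have := inner_self_eq_norm_sq (𝕜 := ℂ) (S.φ (θ + t • EuclideanSpace.single j 1))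
    rw [S.norm_φ _ ht] at this
    simpa using this
  have h3 := h2.hasDerivAt_iff.1 h
  have := h3.unique (hasDerivAt_const (0 : ℝ) (1 : ℝ))
  simpa using this

theorem inner_φ_lift (hθ : θ ∈ S.Θ) (j : Fin m) : inner ℂ (S.φ θ) (S.lift θ j) = 0 := by
  rw [lift, inner_smul_right, inner_sub_right, inner_smul_right, inner_self_eq_norm_sq_to_K,
    S.norm_φ θ hθ]
  simp

theorem inner_lift_eq (j : Fin m) {g : H} (hg : inner ℂ (S.φ θ) g = 0) :
    inner ℂ (S.lift θ j) g = 2 * inner ℂ (S.partialφ θ j) g := by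
  rw [lift, inner_smul_left, inner_sub_left, inner_smul_left, hg, map_ofNat, mul_zero,
    sub_zero]

/-- A measurement with finitely many outcomes is locally unbiased as soon as its first moments
are the right ones. -/
theorem mem_covarianceRegion_of_fintype {ι : Type*} [Fintype ι] (hθ : θ ∈ S.Θ)
    (y : ι → EuclideanSpace ℝ (Fin m)) (E : ι → H →L[ℂ] H) (hE : ∀ k, (E k).IsPositive)
    (hsum : ∑ k, E k = 1) {V : Matrix (Fin m) (Fin m) ℝ}
    (h1 : ∀ i, ∑ k, (inner ℂ (S.φ θ) (E k (S.φ θ))).re * y k i = 0)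
    (h2 : ∀ i j, ∑ k, 2 * (inner ℂ (S.partialφ θ j) (E k (S.φ θ))).re * y k i =
      if i = j then 1 else 0)
    (h3 : ∀ i j, ∑ k, (inner ℂ (S.φ θ) (E k (S.φ θ))).re * (y k i * y k j) = V i j) :
    V ∈ S.covarianceRegion θ := by
  have hsumφ : ∀ χ : H, ∑ k, (inner ℂ χ (E k (S.φ θ))).re = (inner ℂ χ (S.φ θ)).re := by
    intro χ
    rw [← Complex.re_sum, ← inner_sum, ← _root_.sum_apply, hsum]
    rfl
  have hp1 : ∑ k, (inner ℂ (S.φ θ) (E k (S.φ θ))).re = 1 := by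
    have := inner_self_eq_norm_sq (𝕜 := ℂ) (S.φ θ)
    rw [S.norm_φ θ hθ] at this
    rw [hsumφ]
    simpa using this
  -- The derivative of the total probability vanishes, so the constant shift θ in the outcomes θ + y
  -- k does not affect derivatives of the mean.
  have hd0 : ∀ j, ∑ k, 2 * (inner ℂ (S.partialφ θ j) (E k (S.φ θ))).re = 0 := by
    intro j
    rw [← Finset.mul_sum, hsumφ, S.re_inner_partial hθ, mul_zero]
  set M := Measurement.ofFintype (fun k => θ + y k) E hE hsum with hM
  have hmean : ∀ θ', S.mean M θ' =
      ∑ k, (inner ℂ (S.φ θ') (E k (S.φ θ'))).re • (θ + y k) := fun θ' =>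
    Measurement.integral_outcome_ofFintype _ _ _ _ _ _
  have hcoord : ∀ i, ∫ x : EuclideanSpace ℝ (Fin m), x i ∂(M.outcome (S.φ θ)) = θ i := by
    intro i
    rw [Measurement.integral_outcome_ofFintype]
    simp only [PiLp.add_apply, smul_eq_mul, mul_add, Finset.sum_add_distrib]
    rw [← Finset.sum_mul, hp1, h1, one_mul, add_zero]
  refine ⟨M, ⟨?_, ?_, ?_, ?_, ?_⟩, ?_⟩
  · rw [memLp_two_iff_integrable_sq_norm (by fun_prop)]
    exact Measurement.integrable_outcome_ofFintype _ _ _ _ _ _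
  · rw [hmean]
    ext i
    simp only [smul_add, Finset.sum_add_distrib, PiLp.add_apply]
    rw [← Finset.sum_smul, hp1, one_smul]
    simp [h1]
  · exact fun j => Filter.Eventually.of_forall fun t =>
      Measurement.integrable_outcome_ofFintype _ _ _ _ _ _
  · intro j
    simp only [hmean]
    have : HasDerivAt (fun t : ℝ => ∑ k, (inner ℂ (S.φ (θ + t • EuclideanSpace.single j 1))
        (E k (S.φ (θ + t • EuclideanSpace.single j 1)))).re • (θ + y k))
        (∑ k, (2 * (inner ℂ (S.partialφ θ j) (E k (S.φ θ))).re) • (θ + y k)) 0 :=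
      HasDerivAt.fun_sum fun k _ => (S.hasDerivAt_re_inner hθ j (hE k)).smul_const _
    convert this using 1
    ext i
    simp only [smul_add, Finset.sum_add_distrib, PiLp.add_apply]
    rw [← Finset.sum_smul, hd0, zero_smul]
    have := h2 i j
    simp [this]
  · intro i j
    rw [Measurement.integral_outcomeVariation_ofFintype]
    simp only [PiLp.add_apply, mul_add, Finset.sum_add_distrib]
    rw [← Finset.sum_mul, hd0, h2, zero_mul, zero_add]
  · ext i j
    simp only [covarianceMatrix, of_apply, ProbabilityTheory.covariance]
    simp only [hcoord]
    rw [Measurement.integral_outcome_ofFintype]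
    simp [h3]

end PureStateModel

end QuantumEstimation

/-! ### Construction of measurements from rank-one effects -/

namespace QuantumEstimation

open Matrix

/-- Bessel's inequality for a unit vector together with a family orthogonal to it whose Gram matrix
is at most the identity. -/
theorem norm_inner_sq_add_sum_le {m : ℕ} {H : Type*} [NormedAddCommGroup H]
    [InnerProductSpace ℂ H] {φ : H} (hφ : ‖φ‖ = 1) {g : Fin m → H} (hg : ∀ a, inner ℂ φ (g a) = 0)
    (hc : ∀ c : Fin m → ℂ, ‖∑ a, c a • g a‖ ^ 2 ≤ ∑ a, ‖c a‖ ^ 2) (ψ : H) :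
    ‖inner ℂ φ ψ‖ ^ 2 + ∑ a, ‖inner ℂ (g a) ψ‖ ^ 2 ≤ ‖ψ‖ ^ 2 := by
  set s := ‖inner ℂ φ ψ‖ ^ 2 + ∑ a, ‖inner ℂ (g a) ψ‖ ^ 2 with hs
  set v := ∑ a, (inner ℂ (g a) ψ) • g a with hv
  -- u is the operator |φ⟩⟨φ| + Σ |g a⟩⟨g a| applied to ψ. Since ⟨u|ψ⟩ = s and ‖u‖² ≤ s,
  -- Cauchy–Schwarz gives s² ≤ s‖ψ‖².
  set u := (inner ℂ φ ψ) • φ + v with hu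
  have hφv : inner ℂ φ v = 0 := by
    rw [hv, inner_sum]
    exact Finset.sum_eq_zero fun a _ => by rw [inner_smul_right, hg, mul_zero]
  have h1 : ‖u‖ ^ 2 ≤ s := by
    have := norm_add_sq_eq_norm_sq_add_norm_sq_of_inner_eq_zero (𝕜 := ℂ)
      ((inner ℂ φ ψ) • φ) v (by rw [inner_smul_left, hφv, mul_zero])
    rw [sq, this, norm_smul, hφ, mul_one, ← sq, ← sq]
    exact add_le_add le_rfl (hc _)
  have h2 : inner ℂ u ψ = (s : ℂ) := by
    rw [hu, inner_add_left, inner_smul_left, hv, sum_inner, hs]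
    push_cast
    simp only [inner_smul_left, Complex.conj_mul']
  have h3 : s ≤ ‖u‖ * ‖ψ‖ := by
    have := re_inner_le_norm (𝕜 := ℂ) u ψ
    rwa [h2, RCLike.re_eq_complex_re, Complex.ofReal_re] at this
  have hs0 : 0 ≤ s := by positivity
  by_contra! hlt
  nlinarith [norm_nonneg u, norm_nonneg ψ, mul_nonneg (norm_nonneg u) (norm_nonneg ψ),
    sq_nonneg (‖u‖ - ‖ψ‖), sq_nonneg ‖ψ‖]

namespace PureStateModel

variable {m : ℕ} {H : Type*} [NormedAddCommGroup H] [InnerProductSpace ℂ H] [CompleteSpace H]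
  (S : PureStateModel m H) {θ : EuclideanSpace ℝ (Fin m)}

/-- Each g a is split into two effects |f⟩⟨f| with f proportional to φ/√n ± g a, and the estimates
are ± √n times row a of C. The signs make the mean deviation zero, while the cross terms of φ and g
a produce the derivative of the mean and the squares produce CᵀC. -/
theorem mem_covarianceRegion_of_frame (hθ : θ ∈ S.Θ) (g : Fin m → H)
    (hg : ∀ a, inner ℂ (S.φ θ) (g a) = 0)
    (hc : ∀ c : Fin m → ℂ, ‖∑ a, c a • g a‖ ^ 2 ≤ ∑ a, ‖c a‖ ^ 2)
    (C : Matrix (Fin m) (Fin m) ℝ)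
    (hC : ∀ i j, ∑ a, C a i * (inner ℂ (S.lift θ j) (g a)).re = if i = j then 1 else 0) :
    Cᵀ * C ∈ S.covarianceRegion θ := by
  set φ := S.φ θ with hφdef
  have hφ : ‖φ‖ = 1 := S.norm_φ θ hθ
  have hφφ : inner ℂ φ φ = (1 : ℂ) := by rw [inner_self_eq_norm_sq_to_K, hφ]; simp
  -- The pairs together use the share m/n ≤ 1 of |φ⟩⟨φ|; the added 1 keeps n positive when m = 0.
  set n : ℝ := (m : ℝ) + 1 with hn
  have hn0 : 0 < n := by positivity
  set r : ℝ := √n with hr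
  have hr0 : 0 < r := Real.sqrt_pos.2 hn0
  have hrr : r * r = n := Real.mul_self_sqrt hn0.le
  set q : ℝ := √2 with hq
  have hq0 : 0 < q := Real.sqrt_pos.2 two_pos
  have hqq : q * q = 2 := Real.mul_self_sqrt two_pos.le
  set sg : Bool → ℝ := fun b => if b then 1 else -1 with hsg
  set f : Fin m × Bool → H := fun k =>
    (((r * q)⁻¹ : ℝ) : ℂ) • φ + ((sg k.2 * q⁻¹ : ℝ) : ℂ) • g k.1 with hf
  have hfφ : ∀ k, inner ℂ (f k) φ = (((r * q)⁻¹ : ℝ) : ℂ) := by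
    intro k
    have : inner ℂ (g k.1) φ = 0 := inner_eq_zero_symm.1 (hg k.1)
    rw [hf, inner_add_left, inner_smul_left, inner_smul_left, this, hφφ]
    simp
  set P : Fin m × Bool → H →L[ℂ] H := fun k => InnerProductSpace.rankOne ℂ (f k) (f k) with hP
  have hPapp : ∀ k ψ, P k ψ = inner ℂ (f k) ψ • f k := fun k ψ => rfl
  have hPpos : ∀ k, (P k).IsPositive := fun k => InnerProductSpace.isPositive_rankOne_self _
  have hPre : ∀ k ψ, (inner ℂ ψ (P k ψ)).re = ‖inner ℂ (f k) ψ‖ ^ 2 := by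
    intro k ψ
    rw [hPapp, inner_smul_right, ← inner_conj_symm ψ, Complex.mul_conj']
    norm_cast
  -- By the parallelogram law the cross terms of a pair cancel, leaving |φ⟩⟨φ|/n + |g a⟩⟨g a|.
  have hpair : ∀ a ψ, ‖inner ℂ (f (a, true)) ψ‖ ^ 2 + ‖inner ℂ (f (a, false)) ψ‖ ^ 2 =
      n⁻¹ * ‖inner ℂ φ ψ‖ ^ 2 + ‖inner ℂ (g a) ψ‖ ^ 2 := by
    intro a ψ
    simp only [hf, hsg, inner_add_left, inner_smul_left, Complex.conj_ofReal]
    simp only [if_true, Bool.false_eq_true, if_false, one_mul, neg_mul, Complex.ofReal_neg,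
      ← sub_eq_add_neg]
    rw [parallelogram_law_with_norm ℂ, norm_mul, norm_mul, Complex.norm_real,
      Complex.norm_real, Real.norm_of_nonneg (by positivity), Real.norm_of_nonneg (by positivity),
      ← hrr]
    field_simp
    rw [← hqq]
    ring
  set R : H →L[ℂ] H := 1 - ∑ k, P k with hR
  have hRpos : R.IsPositive := by
    rw [ContinuousLinearMap.isPositive_def']
    refine ⟨ContinuousLinearMap.isPositive_one.isSelfAdjoint.sub
      (ContinuousLinearMap.isPositive_sum Finset.univ fun k _ => hPpos k).isSelfAdjoint,
      fun ψ => ?_⟩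
    have h1 : R.reApplyInnerSelf ψ = ‖ψ‖ ^ 2 - ∑ k, ‖inner ℂ (f k) ψ‖ ^ 2 := by
      rw [ContinuousLinearMap.reApplyInnerSelf_apply, ← inner_re_symm, hR, _root_.sub_apply,
        inner_sub_right, map_sub, _root_.sum_apply, inner_sum, map_sum]
      congr 1
      · exact inner_self_eq_norm_sq (𝕜 := ℂ) ψ
      · exact Finset.sum_congr rfl fun k _ => hPre k ψ
    have h2 : ∑ k, ‖inner ℂ (f k) ψ‖ ^ 2 =
        m * (n⁻¹ * ‖inner ℂ φ ψ‖ ^ 2) + ∑ a, ‖inner ℂ (g a) ψ‖ ^ 2 := by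
      rw [Fintype.sum_prod_type]
      simp only [Fintype.sum_bool, hpair, Finset.sum_add_distrib]
      simp
    have h3 : m * (n⁻¹ * ‖inner ℂ φ ψ‖ ^ 2) ≤ ‖inner ℂ φ ψ‖ ^ 2 := by
      rw [← mul_assoc]
      refine mul_le_of_le_one_left (by positivity) ?_
      rw [← div_eq_mul_inv, div_le_one hn0]
      linarith
    have h4 := norm_inner_sq_add_sum_le hφ hg hc ψ
    rw [h1, h2]
    linarith
  have hPφ : ∀ k, (inner ℂ φ (P k φ)).re = ((r * q)⁻¹) ^ 2 := by
    intro k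
    rw [hPre, hfφ, Complex.norm_real, Real.norm_of_nonneg (by positivity)]
  have hPd : ∀ k j, 2 * (inner ℂ (S.partialφ θ j) (P k φ)).re =
      (r * q)⁻¹ * (sg k.2 * q⁻¹) * (inner ℂ (S.lift θ j) (g k.1)).re := by
    intro k j
    rw [hPapp, hfφ, inner_smul_right, Complex.re_ofReal_mul, hf, inner_add_right,
      inner_smul_right, inner_smul_right, Complex.add_re, Complex.re_ofReal_mul,
      Complex.re_ofReal_mul, S.re_inner_partial hθ, S.inner_lift_eq j (hg k.1)]
    simp
    ring
  -- The remainder effect R gets deviation 0, so it contributes to no moment. The factor r offsets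
  -- the probability 1/(2n) of each other outcome: 2 · r²/(2n) = 1.
  let y : Option (Fin m × Bool) → EuclideanSpace ℝ (Fin m) := fun k =>
    k.elim 0 fun k => WithLp.toLp 2 fun i => sg k.2 * r * C k.1 i
  let E : Option (Fin m × Bool) → H →L[ℂ] H := fun k => k.elim R P
  refine S.mem_covarianceRegion_of_fintype hθ y E ?_ ?_ ?_ ?_ ?_
  · rintro (_ | k)
    · exact hRpos
    · exact hPpos k
  · rw [Fintype.sum_option]
    exact sub_add_cancel _ _
  · intro i
    rw [Fintype.sum_option, Fintype.sum_prod_type]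
    simp only [E, y, Option.elim, Fintype.sum_bool, ← hφdef, hPφ, hsg]
    simp
  · intro i j
    rw [Fintype.sum_option, Fintype.sum_prod_type, ← hC i j]
    simp only [E, y, Option.elim, Fintype.sum_bool, ← hφdef, hPd, hsg]
    rw [PiLp.zero_apply, mul_zero, zero_add]
    refine Finset.sum_congr rfl fun a _ => ?_
    simp only [if_true, Bool.false_eq_true, if_false]
    field_simp
    rw [sq, hqq]
    ring
  · intro i j
    rw [Fintype.sum_option, Fintype.sum_prod_type]
    simp only [E, y, Option.elim, Fintype.sum_bool, ← hφdef, hPφ, hsg]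
    rw [PiLp.zero_apply, zero_mul, mul_zero, zero_add, mul_apply]
    refine Finset.sum_congr rfl fun a _ => ?_
    simp only [if_true, Bool.false_eq_true, if_false, transpose_apply]
    field_simp
    rw [sq, hqq]
    ring

/-- A positive definite matrix that dominates the Gram matrix of the dual family of the horizontal
lifts is the covariance matrix of a locally unbiased measurement. -/
theorem mem_covarianceRegion_of_dominates (hθ : θ ∈ S.Θ) (hJ : IsUnit (S.fisher θ).det)
    {V : Matrix (Fin m) (Fin m) ℝ} (hV : V.PosDef)
    (hdom : ∀ a b : Fin m → ℝ, a ⬝ᵥ ((S.fisher θ)⁻¹ *ᵥ a) + b ⬝ᵥ ((S.fisher θ)⁻¹ *ᵥ b) +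
      2 * (b ⬝ᵥ (((S.fisher θ)⁻¹ * S.fisherIm θ * (S.fisher θ)⁻¹) *ᵥ a)) ≤
      a ⬝ᵥ (V *ᵥ a) + b ⬝ᵥ (V *ᵥ b)) :
    V ∈ S.covarianceRegion θ := by
  set C := matSqrt V with hC
  have hCC : C * C = V := matSqrt_mul_self hV.posSemidef
  have hCu : IsUnit C.det := (isUnit_iff_isUnit_det C).1 (isUnit_matSqrt hV)
  have hCt : Cᵀ = C := matSqrt_transpose V
  have hCit : (C⁻¹)ᵀ = C⁻¹ := by rw [transpose_nonsing_inv, hCt]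
  -- Whitening: congruence by C⁻¹ = V^{-1/2} turns the domination of the dual Gram matrix by V into
  -- a Gram matrix at most 1, and duality makes Re⟨lⱼ|g a⟩ the entry of C⁻¹.
  set g : Fin m → H := fun a => ∑ k, ((C⁻¹ a k : ℝ) : ℂ) • dualFamily (S.lift θ) k with hg
  have hgs : ∀ c : Fin m → ℂ, ∑ a, c a • g a =
      ∑ k, ((C⁻¹.map Complex.ofReal) *ᵥ c) k • dualFamily (S.lift θ) k := by
    intro c
    simp only [hg, Finset.smul_sum, mulVec, dotProduct, Finset.sum_smul, smul_smul]
    rw [Finset.sum_comm]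
    refine Finset.sum_congr rfl fun i _ => Finset.sum_congr rfl fun j _ => ?_
    congr 1
    have : C⁻¹ i j = C⁻¹ j i := congrFun (congrFun hCit j) i
    simp [this, mul_comm]
  have hVC : ∀ a : Fin m → ℝ, (C⁻¹ *ᵥ a) ⬝ᵥ (V *ᵥ (C⁻¹ *ᵥ a)) = a ⬝ᵥ a := by
    intro a
    rw [mulVec_dotProduct_mulVec hCit, ← hCC, ← mul_assoc, nonsing_inv_mul _ hCu, one_mul,
      mul_nonsing_inv _ hCu, one_mulVec]
  have hmem := S.mem_covarianceRegion_of_frame hθ g ?_ ?_ C ?_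
  · rwa [hCt, hCC] at hmem
  · intro a
    simp only [hg, dualFamily, inner_sum, inner_smul_right, S.inner_φ_lift hθ]
    simp
  · intro c
    rw [hgs, norm_sq_sum_smul_dualFamily hJ, re_map_mulVec, im_map_mulVec]
    refine (hdom _ _).trans_eq ?_
    rw [hVC, hVC, dotProduct, dotProduct, ← Finset.sum_add_distrib]
    refine Finset.sum_congr rfl fun i _ => ?_
    rw [← Complex.normSq_eq_norm_sq, Complex.normSq_apply]
  · intro i j
    have h1 : ∀ a, (inner ℂ (S.lift θ j) (g a)).re = C⁻¹ a j := by
      intro a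
      simp only [hg, inner_sum, inner_smul_right, Complex.re_sum, Complex.re_ofReal_mul]
      simp only [re_inner_dualFamily (l := S.lift θ) hJ]
      simp
    simp only [h1]
    have h2 : ∑ a, C a i * C⁻¹ a j = (Cᵀ * C⁻¹) i j := by simp [mul_apply]
    rw [h2, hCt, mul_nonsing_inv _ hCu, one_apply]

end PureStateModel

end QuantumEstimation

/-! ### Integration against the outcome variation and the uncertainty relation -/

namespace QuantumEstimation

open scoped ENNReal NNReal

/-- The integral against a signed measure of a function that factors through a simple function. -/
theorem integral_comp_simpleFunc {Ω α : Type*} [MeasurableSpace Ω] (μ : SignedMeasure Ω)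
    [IsFiniteMeasure (VectorMeasure.variation μ)] (F : SimpleFunc Ω α) (u : α → ℝ) :
    ∫ᵛ x, u (F x) ∂•μ = ∑ z ∈ F.range, u z * μ (F ⁻¹' {z}) := by
  have h : ∀ x, u (F x) = ∑ z ∈ F.range, (F ⁻¹' {z}).indicator (fun _ => u z) x := by
    intro x
    rw [Finset.sum_eq_single (F x)]
    · simp
    · intro z _ hz
      exact Set.indicator_of_notMem (fun h => hz h.symm) _
    · intro h
      exact absurd (F.mem_range_self x) h
  simp only [h]
  rw [VectorMeasure.integral_finsetSum]
  · refine Finset.sum_congr rfl fun z _ => ?_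
    rw [VectorMeasure.integral_indicator (F.measurableSet_fiber z), VectorMeasure.integral_const,
      VectorMeasure.restrict_apply _ (F.measurableSet_fiber z) MeasurableSet.univ, Set.univ_inter]
    simp
  · intro z _
    exact (integrable_const (u z)).indicator (F.measurableSet_fiber z)

/-- Positivity of T at χ - zψ. Unlike Cauchy–Schwarz, both sides are linear in T, so the inequality
can be applied to effects and summed over a partition with a different z on each piece. -/
theorem two_mul_re_mul_inner_le {H : Type*} [NormedAddCommGroup H] [InnerProductSpace ℂ H]
    {T : H →L[ℂ] H} (hT : T.IsPositive) (χ ψ : H) (z : ℂ) :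
    2 * (z * inner ℂ χ (T ψ)).re ≤
      (inner ℂ χ (T χ)).re + ‖z‖ ^ 2 * (inner ℂ ψ (T ψ)).re := by
  have h : 0 ≤ (inner ℂ (χ - z • ψ) (T (χ - z • ψ))).re := hT.re_inner_nonneg_right _
  have hs : inner ℂ ψ (T χ) = (starRingEnd ℂ) (inner ℂ χ (T ψ)) := by
    rw [inner_conj_symm]
    exact (hT.isSymmetric ψ χ).symm
  have h1 : (starRingEnd ℂ) z * z = ((‖z‖ ^ 2 : ℝ) : ℂ) := by
    rw [Complex.conj_mul']; norm_cast
  rw [map_sub, map_smul, inner_sub_left, inner_sub_right, inner_sub_right, inner_smul_left,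
    inner_smul_right, inner_smul_left, inner_smul_right, hs, ← map_mul, ← mul_assoc, h1] at h
  simp only [Complex.sub_re, Complex.conj_re, Complex.re_ofReal_mul] at h
  linarith

namespace Measurement

variable {Ω : Type*} [MeasurableSpace Ω] {H : Type*} [NormedAddCommGroup H]
  [InnerProductSpace ℂ H] [CompleteSpace H] (M : Measurement Ω H)

instance isFiniteMeasure_outcome (ψ : H) : IsFiniteMeasure (M.outcome ψ) :=
  ⟨by rw [outcome_apply _ _ MeasurableSet.univ]; exact ENNReal.ofReal_lt_top⟩

theorem outcome_real_apply (ψ : H) {B : Set Ω} (hB : MeasurableSet B) :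
    (M.outcome ψ).real B = (inner ℂ ψ (M.effect B ψ)).re := by
  have h : 0 ≤ (inner ℂ ψ (M.effect B ψ)).re := (M.isPositive B hB).re_inner_nonneg_right ψ
  rw [measureReal_def, outcome_apply _ _ hB, ENNReal.toReal_ofReal h]

theorem mul_abs_outcomeVariation_le (χ ψ : H) {t : ℝ} (ht : 0 ≤ t) {B : Set Ω}
    (hB : MeasurableSet B) :
    t * |M.outcomeVariation χ ψ B| ≤ (M.outcome χ).real B + t ^ 2 * (M.outcome ψ).real B := by
  rw [outcomeVariation_apply _ _ _ hB, outcome_real_apply _ _ hB, outcome_real_apply _ _ hB]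
  have h1 := two_mul_re_mul_inner_le (M.isPositive B hB) χ ψ (t : ℂ)
  have h2 := two_mul_re_mul_inner_le (M.isPositive B hB) χ ψ ((-t : ℝ) : ℂ)
  rw [Complex.re_ofReal_mul, Complex.norm_real, Real.norm_eq_abs, sq_abs] at h1 h2
  rw [neg_sq] at h2
  rw [← abs_of_nonneg ht, ← abs_mul, abs_le, abs_of_nonneg ht]
  constructor <;> linarith

/-- The right side is a measure in B, so the setwise bound passes to the total variation. -/
theorem mul_variation_le (χ ψ : H) (t : ℝ≥0) {B : Set Ω} (hB : MeasurableSet B) :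
    t * (VectorMeasure.variation (M.outcomeVariation χ ψ)) B ≤
      M.outcome χ B + (t : ℝ≥0∞) ^ 2 * M.outcome ψ B := by
  have h := VectorMeasure.variation_apply_le_of_forall_enorm_le
    (μ := t • M.outcomeVariation χ ψ) (m := M.outcome χ + (t : ℝ≥0∞) ^ 2 • M.outcome ψ) hB ?_
  · rw [show t • M.outcomeVariation χ ψ = (t : ℝ) • M.outcomeVariation χ ψ from rfl,
      VectorMeasure.variation_smul, NNReal.nnnorm_eq, Measure.smul_apply, Measure.add_apply,
      Measure.smul_apply, smul_eq_mul, ENNReal.smul_def, smul_eq_mul] at h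
    exact h
  · intro E hE _
    have h1 := M.mul_abs_outcomeVariation_le χ ψ t.coe_nonneg hE
    have h2 : ‖(t • M.outcomeVariation χ ψ) E‖ₑ =
        ENNReal.ofReal (t * |M.outcomeVariation χ ψ E|) := by
      rw [show (t • M.outcomeVariation χ ψ) E = (t : ℝ) * M.outcomeVariation χ ψ E from rfl,
        Real.enorm_eq_ofReal_abs, abs_mul, abs_of_nonneg (NNReal.coe_nonneg t)]
    rw [h2]
    refine (ENNReal.ofReal_le_ofReal h1).trans_eq ?_
    rw [ENNReal.ofReal_add (by positivity) (by positivity), ENNReal.ofReal_mul (by positivity),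
      ofReal_measureReal, ofReal_measureReal]
    rw [Measure.add_apply, Measure.smul_apply, smul_eq_mul, ENNReal.ofReal_pow t.coe_nonneg,
      ENNReal.ofReal_coe_nnreal]

instance isFiniteMeasure_variation (χ ψ : H) :
    IsFiniteMeasure (VectorMeasure.variation (M.outcomeVariation χ ψ)) := by
  refine ⟨lt_of_le_of_lt ?_ (ENNReal.add_lt_top.2
    ⟨measure_lt_top (M.outcome χ) Set.univ, measure_lt_top (M.outcome ψ) Set.univ⟩)⟩
  simpa using M.mul_variation_le χ ψ 1 MeasurableSet.univ

/-- On each fibre of a simple function below f, the parameter t is taken to be the value of that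
function. -/
theorem lintegral_variation_le (χ ψ : H) (f : Ω → ℝ≥0∞) :
    ∫⁻ x, f x ∂(VectorMeasure.variation (M.outcomeVariation χ ψ)) ≤
      M.outcome χ Set.univ + ∫⁻ x, f x ^ 2 ∂(M.outcome ψ) := by
  rw [lintegral_eq_nnreal]
  refine iSup₂_le fun s hs => ?_
  rw [SimpleFunc.map_lintegral]
  calc ∑ t ∈ s.range, (t : ℝ≥0∞) *
        VectorMeasure.variation (M.outcomeVariation χ ψ) (s ⁻¹' {t})
      ≤ ∑ t ∈ s.range, (M.outcome χ (s ⁻¹' {t}) +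
          (t : ℝ≥0∞) ^ 2 * M.outcome ψ (s ⁻¹' {t})) :=
        Finset.sum_le_sum fun t _ => M.mul_variation_le χ ψ t (s.measurableSet_fiber t)
    _ = M.outcome χ Set.univ + (s.map fun t : ℝ≥0 => (t : ℝ≥0∞) ^ 2).lintegral (M.outcome ψ) := by
        rw [Finset.sum_add_distrib, s.sum_range_measure_preimage_singleton,
          SimpleFunc.map_lintegral]
    _ ≤ _ := by
        gcongr
        rw [← SimpleFunc.lintegral_eq_lintegral]
        exact lintegral_mono fun x => pow_le_pow_left' (hs x) 2

/-- A square integrable function is integrable against the variation of the outcome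
distribution. -/
theorem integrable_outcomeVariation (χ ψ : H) {F : Type*} [NormedAddCommGroup F] {f : Ω → F}
    (hf : StronglyMeasurable f) (h2 : MemLp f 2 (M.outcome ψ)) :
    Integrable f (VectorMeasure.variation (M.outcomeVariation χ ψ)) := by
  refine ⟨hf.aestronglyMeasurable, lt_of_le_of_lt (M.lintegral_variation_le χ ψ _)
    (ENNReal.add_lt_top.2 ⟨measure_lt_top _ _, ?_⟩)⟩
  have := lintegral_rpow_enorm_lt_top_of_eLpNorm_lt_top two_ne_zero ENNReal.ofNat_ne_top h2.2
  simpa using this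

/-- On the fibre of z the left side is 2 Re(z⟨w|M(B)ψ⟩), because passing from w to -iw turns Re into
-Im. The positivity inequality with this z is summed over the fibres, whose effects add up to 1. -/
theorem integral_simpleFunc_le (w ψ : H) (F : SimpleFunc Ω ℂ) :
    ∫ᵛ x, (F x).re ∂•(M.outcomeVariation w ψ) +
      ∫ᵛ x, (F x).im ∂•(M.outcomeVariation (-Complex.I • w) ψ) ≤
      ∫ x, ‖F x‖ ^ 2 ∂(M.outcome ψ) + ‖w‖ ^ 2 := by
  rw [integral_comp_simpleFunc _ F Complex.re, integral_comp_simpleFunc _ F Complex.im]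
  have hF : ∫ x, ‖F x‖ ^ 2 ∂(M.outcome ψ) =
      ∑ z ∈ F.range, (M.outcome ψ).real (F ⁻¹' {z}) * ‖z‖ ^ 2 := by
    have := SimpleFunc.map_integral F (fun z : ℂ => ‖z‖ ^ 2)
      (SimpleFunc.integrable_of_isFiniteMeasure F (μ := M.outcome ψ)) (by simp)
    rw [SimpleFunc.integral_eq_integral _ (SimpleFunc.integrable_of_isFiniteMeasure _)] at this
    simpa using this
  have hw : ‖w‖ ^ 2 = ∑ z ∈ F.range, (M.outcome w).real (F ⁻¹' {z}) := by
    have h1 : (M.outcome w).real Set.univ = ‖w‖ ^ 2 := by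
      rw [outcome_real_apply _ _ MeasurableSet.univ, M.univ]
      exact inner_self_eq_norm_sq (𝕜 := ℂ) w
    rw [← h1, measureReal_def, ← F.sum_range_measure_preimage_singleton,
      ENNReal.toReal_sum fun z _ => measure_ne_top _ _]
    rfl
  rw [hF, hw, ← Finset.sum_add_distrib, ← Finset.sum_add_distrib]
  refine Finset.sum_le_sum fun z _ => ?_
  have hz := F.measurableSet_fiber z
  rw [outcomeVariation_apply _ _ _ hz, outcomeVariation_apply _ _ _ hz, outcome_real_apply _ _ hz,
    outcome_real_apply _ _ hz, inner_smul_left]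
  have h := two_mul_re_mul_inner_le (M.isPositive _ hz) w ψ z
  simp only [Complex.mul_re, map_neg, Complex.conj_I, neg_neg, Complex.I_re, Complex.I_im] at h ⊢
  linarith

theorem tendsto_integral_comp (χ ψ : H) (u : ℂ →L[ℝ] ℝ) {F : Ω → ℂ} (hF : Measurable F)
    (hF2 : MemLp F 2 (M.outcome ψ)) {s : ℕ → SimpleFunc Ω ℂ}
    (hs : ∀ x, Filter.Tendsto (fun n => s n x) Filter.atTop (nhds (F x)))
    (hb : ∀ n x, ‖s n x‖ ≤ ‖F x‖ + ‖F x‖) :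
    Filter.Tendsto (fun n => ∫ᵛ x, u (s n x) ∂•(M.outcomeVariation χ ψ)) Filter.atTop
      (nhds (∫ᵛ x, u (F x) ∂•(M.outcomeVariation χ ψ))) := by
  have h := (M.integrable_outcomeVariation χ ψ hF.stronglyMeasurable hF2).norm
  have hint : Integrable (fun x => ‖u‖ * (‖F x‖ + ‖F x‖))
      (VectorMeasure.variation (M.outcomeVariation χ ψ)) := (h.add h).const_mul _
  refine VectorMeasure.tendsto_integral_of_dominated_convergence
    (fun x => ‖u‖ * (‖F x‖ + ‖F x‖)) (fun n => ?_) hint (fun n => ?_) ?_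
  · exact (u.continuous.measurable.comp (s n).measurable).aestronglyMeasurable
  · exact Filter.Eventually.of_forall fun x => (u.le_opNorm _).trans
      (mul_le_mul_of_nonneg_left (hb n x) (norm_nonneg _))
  · exact Filter.Eventually.of_forall fun x => (u.continuous.tendsto _).comp (hs x)

/-- Uncertainty relation: the estimate `Re ∫ F d⟨w|M ψ⟩` is bounded by the second moments. -/
theorem integral_re_add_integral_im_le (w ψ : H) {F : Ω → ℂ} (hF : Measurable F)
    (hF2 : MemLp F 2 (M.outcome ψ)) :
    ∫ᵛ x, (F x).re ∂•(M.outcomeVariation w ψ) +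
      ∫ᵛ x, (F x).im ∂•(M.outcomeVariation (-Complex.I • w) ψ) ≤
      ∫ x, ‖F x‖ ^ 2 ∂(M.outcome ψ) + ‖w‖ ^ 2 := by
  obtain ⟨s, hs, hb⟩ : ∃ s : ℕ → SimpleFunc Ω ℂ,
      (∀ x, Filter.Tendsto (fun n => s n x) Filter.atTop (nhds (F x))) ∧
      ∀ n x, ‖s n x‖ ≤ ‖F x‖ + ‖F x‖ :=
    ⟨fun n => SimpleFunc.approxOn F hF Set.univ 0 trivial n,
      fun x => SimpleFunc.tendsto_approxOn hF (Set.mem_univ 0) (by simp),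
      fun n x => SimpleFunc.norm_approxOn_zero_le hF (Set.mem_univ 0) x n⟩
  have t1 := M.tendsto_integral_comp w ψ Complex.reCLM hF hF2 hs hb
  have t2 := M.tendsto_integral_comp (-Complex.I • w) ψ Complex.imCLM hF hF2 hs hb
  have t3 : Filter.Tendsto (fun n => ∫ x, ‖s n x‖ ^ 2 ∂(M.outcome ψ)) Filter.atTop
      (nhds (∫ x, ‖F x‖ ^ 2 ∂(M.outcome ψ))) := by
    refine tendsto_integral_of_dominated_convergence (fun x => (‖F x‖ + ‖F x‖) ^ 2)
      (fun n => ((s n).measurable.norm.pow_const 2).aestronglyMeasurable)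
      (hF2.norm.add hF2.norm).integrable_sq
      (fun n => Filter.Eventually.of_forall fun x => ?_) (Filter.Eventually.of_forall fun x => ?_)
    · rw [Real.norm_of_nonneg (by positivity)]
      exact pow_le_pow_left₀ (norm_nonneg _) (hb n x) 2
    · exact ((hs x).norm).pow 2
  exact le_of_tendsto_of_tendsto' (t1.add t2) (t3.add_const _)
    fun n => M.integral_simpleFunc_le w ψ (s n)

theorem integral_add_integral_le (w ψ : H) {f g : Ω → ℝ} (hf : Measurable f) (hg : Measurable g)
    (hf2 : MemLp f 2 (M.outcome ψ)) (hg2 : MemLp g 2 (M.outcome ψ)) :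
    ∫ᵛ x, f x ∂•(M.outcomeVariation w ψ) +
      ∫ᵛ x, g x ∂•(M.outcomeVariation (-Complex.I • w) ψ) ≤
      ∫ x, (f x ^ 2 + g x ^ 2) ∂(M.outcome ψ) + ‖w‖ ^ 2 := by
  have hF : Measurable fun x => Complex.mk (f x) (g x) :=
    Complex.measurableEquivRealProd.symm.measurable.comp (hf.prodMk hg)
  have hF2 : MemLp (fun x => Complex.mk (f x) (g x)) 2 (M.outcome ψ) := by
    refine (hf2.norm.add hg2.norm).mono' hF.aestronglyMeasurable
      (Filter.Eventually.of_forall fun x => ?_)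
    exact Complex.norm_le_abs_re_add_abs_im _
  have hnorm : ∀ x, ‖Complex.mk (f x) (g x)‖ ^ 2 = f x ^ 2 + g x ^ 2 := fun x => by
    rw [← Complex.normSq_eq_norm_sq, Complex.normSq_apply, sq, sq]
  simpa only [hnorm] using M.integral_re_add_integral_im_le w ψ hF hF2

end Measurement

end QuantumEstimation

namespace QuantumEstimation

open Matrix

/-! ### Coherence as a complex structure on the real span -/

section CoherentGram

variable {m : ℕ} {H : Type*} [NormedAddCommGroup H] [InnerProductSpace ℂ H]

/-- iB is Hermitian with all eigenvalues ±1, and a diagonalizable matrix of this kind squares to 1.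
-/
theorem mul_self_eq_neg_one_of_transpose {B : Matrix (Fin m) (Fin m) ℝ} (hB : Bᵀ = -B)
    (h : ∀ z ∈ spectrum ℂ (B.map Complex.ofReal), z = Complex.I ∨ z = -Complex.I) :
    B * B = -1 := by
  have hN := isHermitian_I_smul_map hB
  have hBN : B.map Complex.ofReal = (-Complex.I) • (Complex.I • B.map Complex.ofReal) := by
    rw [smul_smul]; simp
  have hev : ∀ i, hN.eigenvalues i * hN.eigenvalues i = 1 := by
    intro i
    have hi : -Complex.I * (hN.eigenvalues i : ℂ) ∈ spectrum ℂ (B.map Complex.ofReal) := by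
      rw [Matrix.mem_spectrum_iff_isRoot_charpoly]
      have hc := charpoly_smul_of_isHermitian hN (-Complex.I)
      rw [← hBN] at hc
      rw [hc, Polynomial.IsRoot.def, Polynomial.eval_prod]
      exact Finset.prod_eq_zero (Finset.mem_univ i) (by simp)
    rcases h _ hi with h1 | h1
    · have := congrArg Complex.im h1
      simp at this
      rw [show hN.eigenvalues i = -1 by linarith]
      norm_num
    · have := congrArg Complex.im h1
      simp at this
      rw [show hN.eigenvalues i = 1 by linarith]
      norm_num
  have hNN : (Complex.I • B.map Complex.ofReal) * (Complex.I • B.map Complex.ofReal) = 1 := by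
    have hs : IsSelfAdjoint (Complex.I • B.map Complex.ofReal) := hN
    conv_lhs => rw [← cfc_id' ℝ (Complex.I • B.map Complex.ofReal)]
    rw [← cfc_mul (fun x : ℝ => x) (fun x : ℝ => x) (Complex.I • B.map Complex.ofReal),
      ← cfc_one ℝ (Complex.I • B.map Complex.ofReal)]
    refine cfc_congr fun x hx => ?_
    rw [hN.spectrum_real_eq_range_eigenvalues] at hx
    obtain ⟨i, rfl⟩ := hx
    exact hev i
  rw [smul_mul_smul_comm, Complex.I_mul_I, neg_smul, one_smul,
    ← show (B * B).map Complex.ofReal = B.map Complex.ofReal * B.map Complex.ofReal from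
      Matrix.map_mul (f := Complex.ofRealHom)] at hNN
  ext i j
  have hij := congrFun (congrFun hNN i) j
  have h2 : (((B * B) i j : ℝ) : ℂ) = ((-(1 : Matrix (Fin m) (Fin m) ℝ) i j : ℝ) : ℂ) := by
    rw [Matrix.neg_apply, Matrix.map_apply] at hij
    rw [neg_eq_iff_eq_neg.1 hij]
    by_cases hd : i = j <;> simp [Matrix.one_apply, hd]
  exact Complex.ofReal_injective h2

/-- J⁻¹T is not antisymmetric, but it is similar to the antisymmetric J^{-1/2} T J^{-1/2}, so
eigenvalues ±i still force its square to be -1. -/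
theorem inv_mul_gramIm_mul_self {l : Fin m → H} (hJ : IsUnit (gramRe l).det)
    (h : ∀ z ∈ spectrum ℂ (((gramRe l)⁻¹ * gramIm l).map Complex.ofReal),
      z = Complex.I ∨ z = -Complex.I) :
    ((gramRe l)⁻¹ * gramIm l) * ((gramRe l)⁻¹ * gramIm l) = -1 := by
  have hPD := gramRe_posDef hJ
  set J := gramRe l
  set T := gramIm l with hT
  set s := matSqrt J
  have hss : s * s = J := matSqrt_mul_self hPD.posSemidef
  have hsu : IsUnit s.det := (isUnit_iff_isUnit_det s).1 (isUnit_matSqrt hPD)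
  have hst : (s⁻¹)ᵀ = s⁻¹ := by rw [transpose_nonsing_inv, matSqrt_transpose]
  have hJi : J⁻¹ = s⁻¹ * s⁻¹ := by rw [← hss, Matrix.mul_inv_rev]
  have hBt : (s⁻¹ * T * s⁻¹)ᵀ = -(s⁻¹ * T * s⁻¹) := by
    rw [transpose_mul, transpose_mul, hst, hT, gramIm_transpose]
    simp [mul_assoc]
  have hB := mul_self_eq_neg_one_of_transpose hBt (by
    intro z hz
    apply h
    rw [Matrix.mem_spectrum_iff_isRoot_charpoly] at hz ⊢
    rwa [hJi, mul_assoc, charpoly_map_mul_comm])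
  have h1 : J⁻¹ * T = s⁻¹ * (s⁻¹ * T * s⁻¹) * s := by
    rw [hJi, mul_assoc, mul_assoc, mul_assoc, mul_assoc, nonsing_inv_mul _ hsu, mul_one]
  rw [h1, show s⁻¹ * (s⁻¹ * T * s⁻¹) * s * (s⁻¹ * (s⁻¹ * T * s⁻¹) * s) =
    s⁻¹ * ((s⁻¹ * T * s⁻¹) * (s * s⁻¹) * (s⁻¹ * T * s⁻¹)) * s by simp only [mul_assoc],
    mul_nonsing_inv _ hsu, mul_one, hB]
  simp [nonsing_inv_mul _ hsu]

/-- In the coherent case the real span of the family is stable under multiplication by `i`. -/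
theorem I_smul_sum_smul {l : Fin m → H} (hJ : IsUnit (gramRe l).det)
    (hD : ((gramRe l)⁻¹ * gramIm l) * ((gramRe l)⁻¹ * gramIm l) = -1) (e : Fin m → ℝ) :
    Complex.I • ∑ k, (e k : ℂ) • l k =
      -∑ k, (((((gramRe l)⁻¹ * gramIm l) *ᵥ e) k : ℝ) : ℂ) • l k := by
  -- The claim is that the combination with coefficients De + ie vanishes. Its squared norm is e·Je
  -- + e·Je - 2 e·Je = 0, as JD = T and TD = -J.
  have h := norm_sq_sum_smul l
    (fun k => (((((gramRe l)⁻¹ * gramIm l) *ᵥ e) k : ℝ) : ℂ) + (e k : ℂ) * Complex.I)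
  set D := (gramRe l)⁻¹ * gramIm l with hDdef
  have hre : (fun k => (((D *ᵥ e) k : ℂ) + (e k : ℂ) * Complex.I).re) = D *ᵥ e := by ext; simp
  have him : (fun k => (((D *ᵥ e) k : ℂ) + (e k : ℂ) * Complex.I).im) = e := by ext; simp
  rw [hre, him] at h
  have hJD : gramRe l * D = gramIm l := mul_nonsing_inv_cancel_left _ _ hJ
  have hTD : gramIm l * D = -gramRe l := by
    rw [← hJD, mul_assoc, hD]; simp
  have h1 : (D *ᵥ e) ⬝ᵥ (gramRe l *ᵥ (D *ᵥ e)) = e ⬝ᵥ (gramRe l *ᵥ e) := by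
    rw [mulVec_mulVec, hJD, ← vecMul_transpose, ← dotProduct_mulVec, mulVec_mulVec, hDdef,
      transpose_mul, gramIm_transpose, inv_gramRe_transpose, neg_mul, neg_mul, mul_assoc,
      ← hDdef, hTD, neg_neg]
  have h2 : e ⬝ᵥ (gramIm l *ᵥ (D *ᵥ e)) = -(e ⬝ᵥ (gramRe l *ᵥ e)) := by
    rw [mulVec_mulVec, hTD, neg_mulVec, dotProduct_neg]
  rw [h1, h2] at h
  have h0 : ∑ k, (((D *ᵥ e) k : ℂ) + (e k : ℂ) * Complex.I) • l k = 0 := by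
    rw [← norm_eq_zero, ← sq_eq_zero_iff, h]; ring
  rw [eq_neg_iff_add_eq_zero, ← h0, Finset.smul_sum, ← Finset.sum_add_distrib]
  refine Finset.sum_congr rfl fun k _ => ?_
  rw [smul_smul, ← add_smul]
  ring_nf

end CoherentGram

/-! ### Domination of the dual Gram matrix by covariance matrices -/

namespace PureStateModel

variable {m : ℕ} {H : Type*} [NormedAddCommGroup H] [InnerProductSpace ℂ H] [CompleteSpace H]
  (S : PureStateModel m H) {θ : EuclideanSpace ℝ (Fin m)}
  {M : Measurement (EuclideanSpace ℝ (Fin m)) H}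

/-- The subtracted component of ∂ⱼφ is an imaginary multiple of φ, and ⟨φ|M(B)φ⟩ is real, so it does
not contribute. -/
theorem outcomeVariation_lift (hθ : θ ∈ S.Θ)
    (M : Measurement (EuclideanSpace ℝ (Fin m)) H) (j : Fin m) :
    M.outcomeVariation (S.lift θ j) (S.φ θ) =
      (2 : ℝ) • M.outcomeVariation (S.partialφ θ j) (S.φ θ) := by
  ext B hB
  rw [_root_.smul_apply, Measurement.outcomeVariation_apply _ _ _ hB,
    Measurement.outcomeVariation_apply _ _ _ hB]
  have him : (inner ℂ (S.φ θ) (M.effect B (S.φ θ))).im = 0 := by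
    have := (M.isPositive B hB).isSymmetric.im_inner_self_apply (S.φ θ)
    simpa using this
  have hre := S.re_inner_partial hθ j
  rw [lift, inner_smul_left, inner_sub_left, inner_smul_left, inner_conj_symm, map_ofNat]
  simp [Complex.mul_re, him, hre]

theorem outcomeVariation_sum (M : Measurement (EuclideanSpace ℝ (Fin m)) H) (α : Fin m → ℝ)
    (l : Fin m → H) (ψ : H) :
    M.outcomeVariation (∑ j, (α j : ℂ) • l j) ψ = ∑ j, α j • M.outcomeVariation (l j) ψ := by
  ext B hB
  rw [Measurement.outcomeVariation_apply _ _ _ hB, _root_.sum_apply, sum_inner, Complex.re_sum,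
    Finset.mul_sum]
  refine Finset.sum_congr rfl fun j _ => ?_
  rw [_root_.smul_apply, Measurement.outcomeVariation_apply _ _ _ hB, inner_smul_left,
    Complex.conj_ofReal, Complex.re_ofReal_mul, smul_eq_mul]
  ring

theorem memLp_coord (hM : S.IsLocallyUnbiased M θ) (i : Fin m) :
    MemLp (fun x : EuclideanSpace ℝ (Fin m) => x i) 2 (M.outcome (S.φ θ)) := by
  refine hM.memLp.mono (by fun_prop) (Filter.Eventually.of_forall fun x => ?_)
  exact PiLp.norm_apply_le x i

theorem integral_coord (hM : S.IsLocallyUnbiased M θ) (i : Fin m) :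
    ∫ x : EuclideanSpace ℝ (Fin m), x i ∂(M.outcome (S.φ θ)) = θ i := by
  have h := congrArg (fun v : EuclideanSpace ℝ (Fin m) => v i) hM.mean_eq
  rw [← h]
  exact ((EuclideanSpace.proj (𝕜 := ℝ) i).integral_comp_comm
    (hM.memLp.integrable one_le_two))

theorem memLp_linear (hM : S.IsLocallyUnbiased M θ) (a : Fin m → ℝ) :
    MemLp (fun x : EuclideanSpace ℝ (Fin m) => ∑ i, a i * (x i - θ i)) 2
      (M.outcome (S.φ θ)) :=
  memLp_finsetSum _ fun i _ => ((S.memLp_coord hM i).sub (memLp_const _)).const_mul _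

theorem integral_linear_sq (hM : S.IsLocallyUnbiased M θ) (a : Fin m → ℝ) :
    ∫ x : EuclideanSpace ℝ (Fin m), (∑ i, a i * (x i - θ i)) ^ 2 ∂(M.outcome (S.φ θ)) =
      a ⬝ᵥ (S.covarianceMatrix M θ *ᵥ a) := by
  have hint : ∀ i j, Integrable (fun x : EuclideanSpace ℝ (Fin m) => (x i - θ i) * (x j - θ j))
      (M.outcome (S.φ θ)) := fun i j =>
    ((S.memLp_coord hM i).sub (memLp_const _)).integrable_mul
      ((S.memLp_coord hM j).sub (memLp_const _))
  have h : ∀ x : EuclideanSpace ℝ (Fin m), (∑ i, a i * (x i - θ i)) ^ 2 =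
      ∑ i, ∑ j, a i * a j * ((x i - θ i) * (x j - θ j)) := by
    intro x
    rw [sq, Finset.sum_mul_sum]
    refine Finset.sum_congr rfl fun i _ => Finset.sum_congr rfl fun j _ => ?_
    ring
  simp only [h]
  rw [integral_finsetSum _ fun i _ => integrable_finsetSum _ fun j _ => (hint i j).const_mul _]
  simp only [dotProduct, mulVec, Finset.mul_sum]
  refine Finset.sum_congr rfl fun i _ => ?_
  rw [integral_finsetSum _ fun j _ => (hint i j).const_mul _]
  refine Finset.sum_congr rfl fun j _ => ?_
  rw [integral_const_mul, covarianceMatrix, of_apply, ProbabilityTheory.covariance]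
  simp only [S.integral_coord hM]
  ring

theorem integral_linear_outcomeVariation (hθ : θ ∈ S.Θ) (hM : S.IsLocallyUnbiased M θ)
    (a α : Fin m → ℝ) :
    ∫ᵛ x, (∑ i, a i * (x i - θ i)) ∂•(M.outcomeVariation (∑ j, (α j : ℂ) • S.lift θ j) (S.φ θ)) =
      2 * (a ⬝ᵥ α) := by
  have hx : ∀ i j, Integrable (fun x : EuclideanSpace ℝ (Fin m) => x i)
      (VectorMeasure.variation (M.outcomeVariation (S.lift θ j) (S.φ θ))) := fun i j =>
    M.integrable_outcomeVariation _ _ (Measurable.stronglyMeasurable (by fun_prop))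
      (S.memLp_coord hM i)
  have hlin : ∀ j, Integrable (fun x : EuclideanSpace ℝ (Fin m) => ∑ i, a i * (x i - θ i))
      (VectorMeasure.variation (M.outcomeVariation (S.lift θ j) (S.φ θ))) := fun j =>
    integrable_finsetSum _ fun i _ => ((hx i j).sub (integrable_const _)).const_mul _
  have hone : ∀ i j, ∫ᵛ x, (x i - θ i) ∂•(M.outcomeVariation (S.lift θ j) (S.φ θ)) =
      2 * if i = j then 1 else 0 := by
    intro i j
    rw [VectorMeasure.integral_fun_sub (hx i j) (integrable_const _), VectorMeasure.integral_const,
      S.outcomeVariation_lift hθ, VectorMeasure.integral_smul_vectorMeasure,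
      hM.deriv_under_integral, _root_.smul_apply,
      Measurement.outcomeVariation_apply _ _ _ MeasurableSet.univ, M.univ]
    have := S.re_inner_partial hθ j
    simp [this]
  rw [outcomeVariation_sum, VectorMeasure.integral_finsetSum_vectorMeasure
    fun j _ => VectorMeasure.Integrable.smul_vectorMeasure (hlin j) (α j)]
  simp only [VectorMeasure.integral_smul_vectorMeasure]
  have hj : ∀ j, ∫ᵛ x, (∑ i, a i * (x i - θ i)) ∂•(M.outcomeVariation (S.lift θ j) (S.φ θ)) =
      2 * a j := by
    intro j
    have hi : ∀ i ∈ Finset.univ, VectorMeasure.Integrable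
        (M.outcomeVariation (S.lift θ j) (S.φ θ))
        (fun x : EuclideanSpace ℝ (Fin m) => a i * (x i - θ i)) := fun i _ =>
      ((hx i j).sub (integrable_const _)).const_mul _
    rw [VectorMeasure.integral_finsetSum _ hi]
    have : ∀ i, ∫ᵛ x, a i * (x i - θ i) ∂•(M.outcomeVariation (S.lift θ j) (S.φ θ)) =
        a i * (2 * if i = j then 1 else 0) := fun i => by
      rw [← hone i j]
      exact VectorMeasure.integral_fun_smul _ _ (a i) _
    simp only [this]
    simp
    ring
  simp only [hj, dotProduct, Finset.mul_sum, smul_eq_mul]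
  exact Finset.sum_congr rfl fun j _ => by ring

/-- Every covariance matrix of a locally unbiased measurement dominates the Gram matrix of the dual
family of the horizontal lifts, if the model is coherent. -/
theorem dominates_of_mem_covarianceRegion (hθ : θ ∈ S.Θ) (hcoh : S.IsCoherentAt θ)
    {V : Matrix (Fin m) (Fin m) ℝ} (hV : V ∈ S.covarianceRegion θ) (a b : Fin m → ℝ) :
    a ⬝ᵥ ((S.fisher θ)⁻¹ *ᵥ a) + b ⬝ᵥ ((S.fisher θ)⁻¹ *ᵥ b) +
      2 * (b ⬝ᵥ (((S.fisher θ)⁻¹ * S.fisherIm θ * (S.fisher θ)⁻¹) *ᵥ a)) ≤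
      a ⬝ᵥ (V *ᵥ a) + b ⬝ᵥ (V *ᵥ b) := by
  obtain ⟨M, hM, rfl⟩ := hV
  obtain ⟨hJ, hsp⟩ := hcoh
  rw [fisher_eq_gramRe] at hJ
  rw [fisher_eq_gramRe, fisherIm_eq_gramIm] at hsp ⊢
  set l := S.lift θ
  set A := (gramRe l)⁻¹
  set T := gramIm l with hT
  have hD : (A * T) * (A * T) = -1 := inv_mul_gramIm_mul_self hJ hsp
  have hI := I_smul_sum_smul hJ hD
  have hAt : Aᵀ = A := inv_gramRe_transpose l
  have hKt : (A * T * A)ᵀ = -(A * T * A) := by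
    rw [transpose_mul, transpose_mul, hAt, hT, gramIm_transpose]
    simp [mul_assoc]
  set L : (Fin m → ℝ) → H := fun e => ∑ k, (e k : ℂ) • l k with hL
  have hLsub : ∀ e f, L (e - f) = L e - L f := fun e f => by
    simp [hL, sub_smul, Finset.sum_sub_distrib]
  have hLadd : ∀ e f, L (e + f) = L e + L f := fun e f => by
    simp [hL, add_smul, Finset.sum_add_distrib]
  have hIL : ∀ e, Complex.I • L e = -L ((A * T) *ᵥ e) := hI
  set w : H := ∑ k, ((a k : ℂ) + (b k : ℂ) * Complex.I) • dualFamily l k with hw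
  have hre : (fun k => ((a k : ℂ) + (b k : ℂ) * Complex.I).re) = a := by ext; simp
  have him : (fun k => ((a k : ℂ) + (b k : ℂ) * Complex.I).im) = b := by ext; simp
  have hwn : ‖w‖ ^ 2 = a ⬝ᵥ (A *ᵥ a) + b ⬝ᵥ (A *ᵥ b) + 2 * (b ⬝ᵥ ((A * T * A) *ᵥ a)) := by
    rw [hw, norm_sq_sum_smul_dualFamily hJ, hre, him]
  have hwL : w = L (A *ᵥ a) + Complex.I • L (A *ᵥ b) := by
    rw [hw, sum_smul_dualFamily, hL, Finset.smul_sum, ← Finset.sum_add_distrib]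
    refine Finset.sum_congr rfl fun k _ => ?_
    rw [smul_smul, ← add_smul]
    congr 1
    apply Complex.ext
    · have := congrFun (re_map_mulVec A (fun k => (a k : ℂ) + (b k : ℂ) * Complex.I)) k
      rw [hre] at this
      simpa using this
    · have := congrFun (im_map_mulVec A (fun k => (a k : ℂ) + (b k : ℂ) * Complex.I)) k
      rw [him] at this
      simpa using this
  -- This is where coherence enters: w and -iw become real combinations of lifts, the only
  -- directions about which local unbiasedness says anything.
  have hw1 : w = L (A *ᵥ a - (A * T * A) *ᵥ b) := by
    rw [hwL, hIL, hLsub, mulVec_mulVec, sub_eq_add_neg]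
  have hw2 : -Complex.I • w = L (A *ᵥ b + (A * T * A) *ᵥ a) := by
    rw [hwL, smul_add, smul_smul, neg_mul, Complex.I_mul_I, neg_neg, one_smul, neg_smul, hIL,
      neg_neg, hLadd, mulVec_mulVec, add_comm]
  have key := M.integral_add_integral_le w (S.φ θ)
    (f := fun x : EuclideanSpace ℝ (Fin m) => ∑ i, a i * (x i - θ i))
    (g := fun x : EuclideanSpace ℝ (Fin m) => ∑ i, b i * (x i - θ i))
    (by fun_prop) (by fun_prop) (S.memLp_linear hM a) (S.memLp_linear hM b)
  rw [integral_add (S.memLp_linear hM a).integrable_sq (S.memLp_linear hM b).integrable_sq,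
    S.integral_linear_sq hM, S.integral_linear_sq hM, hw2, hwn, hw1] at key
  -- The left side becomes 2‖w‖², one copy of which cancels the term ‖w‖² on the right.
  rw [S.integral_linear_outcomeVariation hθ hM, S.integral_linear_outcomeVariation hθ hM,
    dotProduct_sub, dotProduct_add] at key
  have hsw : a ⬝ᵥ ((A * T * A) *ᵥ b) = -(b ⬝ᵥ ((A * T * A) *ᵥ a)) := by
    rw [← vecMul_transpose, hKt, dotProduct_comm, ← dotProduct_mulVec, neg_mulVec, dotProduct_neg]
  rw [hsw] at key
  linarith

end PureStateModel

end QuantumEstimation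

/-! ### The bound, its attainment, and singular weights -/

namespace QuantumEstimation

open Matrix

theorem trace_mul_nonneg_of_posSemidef {m : ℕ} {P V : Matrix (Fin m) (Fin m) ℝ}
    (hP : P.PosSemidef) (hV : V.PosSemidef) : 0 ≤ (P * V).trace := by
  rw [← matSqrt_mul_self hP, mul_assoc, trace_mul_comm, mul_assoc]
  have h := hV.mul_mul_conjTranspose_same (matSqrt P)
  rw [conjTranspose_eq_transpose_of_trivial, matSqrt_transpose, mul_assoc] at h
  exact h.trace_nonneg

namespace PureStateModel

variable {m : ℕ} {H : Type*} [NormedAddCommGroup H] [InnerProductSpace ℂ H] [CompleteSpace H]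
  (S : PureStateModel m H) {θ : EuclideanSpace ℝ (Fin m)}

/-- The matrix `Jˢ⁻¹ J̃ Jˢ⁻¹`. -/
noncomputable def dualIm (S : PureStateModel m H) (θ : EuclideanSpace ℝ (Fin m)) :
    Matrix (Fin m) (Fin m) ℝ :=
  (S.fisher θ)⁻¹ * S.fisherIm θ * (S.fisher θ)⁻¹

theorem inv_fisher_transpose : ((S.fisher θ)⁻¹)ᵀ = (S.fisher θ)⁻¹ := inv_gramRe_transpose _

theorem dualIm_transpose : (S.dualIm θ)ᵀ = -S.dualIm θ := by
  rw [dualIm, transpose_mul, transpose_mul, inv_fisher_transpose, fisherIm_eq_gramIm,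
    gramIm_transpose]
  simp [mul_assoc]

theorem conj_dualIm_transpose {s : Matrix (Fin m) (Fin m) ℝ} (hs : sᵀ = s) :
    (s * S.dualIm θ * s)ᵀ = -(s * S.dualIm θ * s) := by
  rw [transpose_mul, transpose_mul, hs, dualIm_transpose]
  simp [mul_assoc]

theorem coherentBound_eq {G : Matrix (Fin m) (Fin m) ℝ} (hG : G.PosSemidef) :
    S.coherentBound θ G =
      (G * (S.fisher θ)⁻¹).trace + trAbs (matSqrt G * S.dualIm θ * matSqrt G) := by
  have h : G * (S.fisher θ)⁻¹ * S.fisherIm θ * (S.fisher θ)⁻¹ =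
      matSqrt G * (matSqrt G * S.dualIm θ) := by
    rw [← mul_assoc, matSqrt_mul_self hG, dualIm]
    simp only [mul_assoc]
  rw [coherentBound, h, trAbs_mul_comm]

theorem covarianceMatrix_transpose (M : Measurement (EuclideanSpace ℝ (Fin m)) H) :
    (S.covarianceMatrix M θ)ᵀ = S.covarianceMatrix M θ := by
  ext i j
  simp only [covarianceMatrix, transpose_apply, of_apply]
  exact ProbabilityTheory.covariance_comm _ _

theorem coherentBound_le (hθ : θ ∈ S.Θ) (hcoh : S.IsCoherentAt θ)
    {G : Matrix (Fin m) (Fin m) ℝ} (hG : G.PosSemidef) {V : Matrix (Fin m) (Fin m) ℝ}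
    (hV : V ∈ S.covarianceRegion θ) : S.coherentBound θ G ≤ (G * V).trace := by
  have hVt : Vᵀ = V := by
    obtain ⟨M, -, rfl⟩ := hV
    exact S.covarianceMatrix_transpose M
  have hdom := S.dominates_of_mem_covarianceRegion hθ hcoh hV
  have hst : (matSqrt G)ᵀ = matSqrt G := matSqrt_transpose G
  have h := trAbs_le_trace (W := matSqrt G * (V - (S.fisher θ)⁻¹) * matSqrt G)
    (by rw [transpose_mul, transpose_mul, transpose_sub, hst, hVt, inv_fisher_transpose, mul_assoc])
    (S.conj_dualIm_transpose hst) (fun a b => by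
      rw [← mulVec_dotProduct_mulVec hst, ← mulVec_dotProduct_mulVec hst,
        ← mulVec_dotProduct_mulVec hst]
      have := hdom (matSqrt G *ᵥ a) (matSqrt G *ᵥ b)
      rw [sub_mulVec, dotProduct_sub, sub_mulVec, dotProduct_sub, dualIm]
      linarith)
  rw [trace_mul_comm, ← mul_assoc, matSqrt_mul_self hG, mul_sub, trace_sub] at h
  rw [S.coherentBound_eq hG]
  linarith

/-- The matrix `Jˢ⁻¹ + s⁻¹ |s Jˢ⁻¹ J̃ Jˢ⁻¹ s| s⁻¹`, the optimal covariance matrix for the weight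
`s²`. -/
noncomputable def optimalCovariance (S : PureStateModel m H) (θ : EuclideanSpace ℝ (Fin m))
    (s : Matrix (Fin m) (Fin m) ℝ) : Matrix (Fin m) (Fin m) ℝ :=
  (S.fisher θ)⁻¹ + s⁻¹ * matAbs (s * S.dualIm θ * s) * s⁻¹

theorem optimalCovariance_posDef (hJ : IsUnit (S.fisher θ).det)
    {s : Matrix (Fin m) (Fin m) ℝ} (hs : sᵀ = s) : (S.optimalCovariance θ s).PosDef := by
  have hst : (s⁻¹)ᵀ = s⁻¹ := by rw [transpose_nonsing_inv, hs]
  refine (gramRe_posDef hJ).inv.add_posSemidef ?_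
  have h := (matSqrt_posSemidef
    ((s * S.dualIm θ * s) * (s * S.dualIm θ * s)ᵀ)).mul_mul_conjTranspose_same s⁻¹
  rwa [conjTranspose_eq_transpose_of_trivial, hst] at h

/-- With X = sKs, the congruence by s⁻¹ carries |X| ≥ iX to s⁻¹|X|s⁻¹ ≥ iK, which is the required
domination. -/
theorem optimalCovariance_mem (hθ : θ ∈ S.Θ) (hJ : IsUnit (S.fisher θ).det)
    {s : Matrix (Fin m) (Fin m) ℝ} (hs : sᵀ = s) (hu : IsUnit s.det) :
    S.optimalCovariance θ s ∈ S.covarianceRegion θ := by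
  have hst : (s⁻¹)ᵀ = s⁻¹ := by rw [transpose_nonsing_inv, hs]
  refine S.mem_covarianceRegion_of_dominates hθ hJ (S.optimalCovariance_posDef hJ hs)
    fun a b => ?_
  have h := two_mul_dotProduct_le_matAbs (S.conj_dualIm_transpose (θ := θ) hs)
    (s⁻¹ *ᵥ a) (s⁻¹ *ᵥ b)
  simp only [mulVec_dotProduct_mulVec hst] at h
  have hK : s⁻¹ * (s * S.dualIm θ * s) * s⁻¹ = S.dualIm θ := by
    rw [mul_assoc, mul_assoc, mul_assoc, mul_nonsing_inv _ hu, mul_one, ← mul_assoc,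
      nonsing_inv_mul _ hu, one_mul]
  rw [hK] at h
  rw [optimalCovariance, add_mulVec, add_mulVec, dotProduct_add, dotProduct_add]
  rw [dualIm] at h ⊢
  linarith

theorem trace_mul_optimalCovariance {s : Matrix (Fin m) (Fin m) ℝ} (hs : sᵀ = s)
    (hu : IsUnit s.det) :
    (s * s * S.optimalCovariance θ s).trace =
      (s * s * (S.fisher θ)⁻¹).trace + trAbs (s * S.dualIm θ * s) := by
  rw [optimalCovariance, mul_add, trace_add, ← trace_matAbs (S.conj_dualIm_transpose hs)]
  congr 1
  rw [mul_assoc, mul_assoc, ← mul_assoc s s⁻¹, mul_nonsing_inv _ hu, one_mul, trace_mul_comm,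
    mul_assoc, nonsing_inv_mul _ hu, mul_one]

/-- For a singular weight the bound is approached with the weights `(G^{1/2} + ε)²`. -/
theorem exists_forall_trace_le (hθ : θ ∈ S.Θ) (hJ : IsUnit (S.fisher θ).det)
    {G : Matrix (Fin m) (Fin m) ℝ} (hG : G.PosSemidef) :
    ∃ p q : ℝ, ∀ ε : ℝ, 0 < ε → ∃ V ∈ S.covarianceRegion θ,
      (G * V).trace ≤ S.coherentBound θ G + ε * p + ε ^ 2 * q := by
  set r := matSqrt G with hr
  set K := S.dualIm θ with hK
  set A := (S.fisher θ)⁻¹ with hA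
  have hrt : rᵀ = r := matSqrt_transpose G
  have hrP : r.PosSemidef := matSqrt_posSemidef G
  obtain ⟨c, hc⟩ := exists_two_mul_dotProduct_le (r * K + K * r)
  obtain ⟨d, hd⟩ := exists_two_mul_dotProduct_le K
  refine ⟨2 * (r * A).trace + m * c, A.trace + m * d, fun ε hε => ?_⟩
  set s := r + ε • (1 : Matrix (Fin m) (Fin m) ℝ) with hs
  have hst : sᵀ = s := by rw [hs, transpose_add, hrt, transpose_smul, transpose_one]
  have hsP : s.PosDef := PosDef.posSemidef_add hrP (PosDef.one.smul hε)
  have hu : IsUnit s.det := (isUnit_iff_isUnit_det s).1 hsP.isUnit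
  have hss : s * s = G + ((2 * ε) • r + ε ^ 2 • (1 : Matrix (Fin m) (Fin m) ℝ)) := by
    rw [hs, add_mul, mul_add, mul_add, matSqrt_mul_self hG, two_mul, add_smul, sq, mul_smul]
    simp
    abel
  have hsKs : s * K * s = r * K * r + ε • (r * K + K * r) + ε ^ 2 • K := by
    rw [hs, add_mul, add_mul, mul_add, mul_add, sq, mul_smul]
    simp
    abel
  refine ⟨_, S.optimalCovariance_mem hθ hJ hst hu, ?_⟩
  have h1 := S.trace_mul_optimalCovariance (θ := θ) hst hu
  -- G ≤ s², so the cost for G is at most the cost for the invertible weight s², which is known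
  -- exactly.
  have h2 : (G * S.optimalCovariance θ s).trace ≤ (s * s * S.optimalCovariance θ s).trace := by
    rw [hss, add_mul, trace_add]
    have := trace_mul_nonneg_of_posSemidef
      ((hrP.smul (by positivity : 0 ≤ 2 * ε)).add (PosSemidef.one.smul (by positivity : 0 ≤ ε ^ 2)))
      (S.optimalCovariance_posDef hJ hst).posSemidef
    linarith
  have h3 : (s * s * A).trace = (G * A).trace + ε * (2 * (r * A).trace) + ε ^ 2 * A.trace := by
    rw [hss]
    simp only [add_mul, trace_add, smul_mul_assoc, trace_smul, one_mul, smul_eq_mul]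
    ring
  have h4 : trAbs (s * K * s) ≤ trAbs (r * K * r) + ε * (m * c) + ε ^ 2 * (m * d) := by
    -- |rKr| plus a multiple of the identity dominates i(sKs), and its trace bounds Tr abs from
    -- above. No continuity of eigenvalues is needed.
    have h := trAbs_le_trace
      (W := matAbs (r * K * r) + (ε * c + ε ^ 2 * d) • (1 : Matrix (Fin m) (Fin m) ℝ))
      (by rw [transpose_add, transpose_smul, transpose_one, matAbs, matSqrt_transpose])
      (S.conj_dualIm_transpose (θ := θ) hst) (fun a b => by
        rw [← hK, hsKs]
        have e1 := two_mul_dotProduct_le_matAbs (S.conj_dualIm_transpose (θ := θ) hrt) a b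
        have e2 := mul_le_mul_of_nonneg_left (hc a b) hε.le
        have e3 := mul_le_mul_of_nonneg_left (hd a b) (sq_nonneg ε)
        rw [← hK] at e1
        simp only [add_mulVec, smul_mulVec, one_mulVec, dotProduct_add, dotProduct_smul,
          smul_eq_mul] at e1 e2 e3 ⊢
        linarith)
    rw [trace_add, trace_matAbs (S.conj_dualIm_transpose hrt), trace_smul, trace_one,
      Fintype.card_fin, smul_eq_mul] at h
    linarith
  rw [S.coherentBound_eq hG]
  linarith

theorem isGLB_weightedCosts (hθ : θ ∈ S.Θ) (hcoh : S.IsCoherentAt θ)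
    {G : Matrix (Fin m) (Fin m) ℝ} (hG : G.PosSemidef) :
    IsGLB (S.weightedCosts θ G) (S.coherentBound θ G) := by
  refine ⟨?_, fun β hβ => ?_⟩
  · rintro _ ⟨V, hV, rfl⟩
    exact S.coherentBound_le hθ hcoh hG hV
  · obtain ⟨p, q, h⟩ := S.exists_forall_trace_le hθ hcoh.1 hG
    have hlim : Filter.Tendsto (fun ε : ℝ => S.coherentBound θ G + ε * p + ε ^ 2 * q)
        (nhdsWithin 0 (Set.Ioi 0)) (nhds (S.coherentBound θ G)) := by
      have hc : Continuous fun ε : ℝ => S.coherentBound θ G + ε * p + ε ^ 2 * q := by fun_prop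
      have := hc.tendsto 0
      simp only [zero_mul, add_zero, ne_eq, OfNat.ofNat_ne_zero, not_false_eq_true,
        zero_pow] at this
      exact this.mono_left nhdsWithin_le_nhds
    refine ge_of_tendsto hlim ?_
    filter_upwards [self_mem_nhdsWithin] with ε hε
    obtain ⟨V, hV, hle⟩ := h ε hε
    exact (hβ ⟨V, hV, rfl⟩).trans hle

theorem weightedCosts_nonempty (hθ : θ ∈ S.Θ) (hJ : IsUnit (S.fisher θ).det)
    (G : Matrix (Fin m) (Fin m) ℝ) : (S.weightedCosts θ G).Nonempty :=
  -- The covariance region does not depend on G, so the optimum for the identity weight serves as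
  -- witness.
  ⟨_, _, S.optimalCovariance_mem hθ hJ (s := 1) transpose_one (by simp), rfl⟩

theorem crBound_eq_coherentBound (hθ : θ ∈ S.Θ) (hcoh : S.IsCoherentAt θ)
    {G : Matrix (Fin m) (Fin m) ℝ} (hG : G.PosSemidef) :
    S.crBound θ G = S.coherentBound θ G :=
  (S.isGLB_weightedCosts hθ hcoh hG).csInf_eq (S.weightedCosts_nonempty hθ hcoh.1 G)

theorem coherentCovariance_eq (G : Matrix (Fin m) (Fin m) ℝ) :
    S.coherentCovariance θ G = S.optimalCovariance θ (matSqrt G) := by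
  rw [coherentCovariance, optimalCovariance, dualIm]
  simp only [mul_assoc]

end PureStateModel

end QuantumEstimation

theorem mainTheorem1 {m : ℕ} {H : Type*} [NormedAddCommGroup H] [InnerProductSpace ℂ H]
    [CompleteSpace H] (S : QuantumEstimation.PureStateModel m H)
    (θ : EuclideanSpace ℝ (Fin m)) (hθ : θ ∈ S.Θ) (hcoh : S.IsCoherentAt θ) :
    (∀ G : Matrix (Fin m) (Fin m) ℝ, G.PosSemidef →
      IsGLB (S.weightedCosts θ G) (S.crBound θ G) ∧
      S.crBound θ G = S.coherentBound θ G) ∧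
    (∀ G : Matrix (Fin m) (Fin m) ℝ, G.PosDef →
      IsLeast (S.weightedCosts θ G) (S.crBound θ G) ∧
      S.coherentCovariance θ G ∈ S.covarianceRegion θ ∧
      (G * S.coherentCovariance θ G).trace = S.crBound θ G) := by
  have hcr := fun (G : Matrix (Fin m) (Fin m) ℝ) (hG : G.PosSemidef) =>
    S.crBound_eq_coherentBound hθ hcoh hG
  refine ⟨fun G hG => ⟨hcr G hG ▸ S.isGLB_weightedCosts hθ hcoh hG, hcr G hG⟩, fun G hG => ?_⟩
  have hst := QuantumEstimation.matSqrt_transpose G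
  have hu := (Matrix.isUnit_iff_isUnit_det _).1 (QuantumEstimation.isUnit_matSqrt hG)
  have hmem : S.coherentCovariance θ G ∈ S.covarianceRegion θ := by
    rw [S.coherentCovariance_eq]
    exact S.optimalCovariance_mem hθ hcoh.1 hst hu
  have htr : (G * S.coherentCovariance θ G).trace = S.crBound θ G := by
    have h := S.trace_mul_optimalCovariance (θ := θ) hst hu
    rw [QuantumEstimation.matSqrt_mul_self hG.posSemidef] at h
    rw [S.coherentCovariance_eq, h, hcr G hG.posSemidef, S.coherentBound_eq hG.posSemidef]
  refine ⟨⟨⟨_, hmem, htr⟩, ?_⟩, hmem, htr⟩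
  rw [hcr G hG.posSemidef]
  exact (S.isGLB_weightedCosts hθ hcoh hG.posSemidef).1
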